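/- **Setting.** A seller faces one buyer over $T\ge 1$ rounds. In round $t$ the buyer has a value $v_t\in[0,1]$, the seller posts a price $p_t\in[0,1]$ and observes only the bit $\sigma_t=\mathbf 1\{p_t\le v_t\}$. An online pricing algorithm may be randomized: the law of $p_{t}$ depends on $(p_s,\sigma_s)_{s<t}$ only (and on the horizon $T$). Given rates $1\ge\varepsilon_1\ge\varepsilon_2\ge\dots\ge 0$, a stochastic buyer with changing rates $(\varepsilon_t)$ is an adaptive adversary that chooses the law of $v_1$ on $[0,1]$ and, given $(v_s,p_s)_{s\le t}$, the law of $v_{t+1}-v_t$, which has mean zero and is supported in $[-\varepsilon_t,\varepsilon_t]$, so that $v_{t+1}\in[0,1]$; thus $(v_t)$ is a martingale in $[0,1]$. Given the past, $v_{t+1}$ and $p_{t+1}$ are independent. The loss of an algorithm is its expected average revenue loss $\mathbb E\big[\frac1T\sum_{t=1}^T (v_t-p_t\sigma_t)\big]$. Put $\bar\varepsilon=\frac1T\sum_{t=1}^T\varepsilon_t$. **Theorem.** 1. There are constants $C$, $k$ and, for every $T\ge1$, an online pricing algorithm $A_T$ that does not know the rates, such that for all $T\ge1$, all non-increasing rates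 $\varepsilon_t\in[0,1]$ and all stochastic buyers with changing rates $(\varepsilon_t)$ the loss of $A_T$ is at most $$C\,\bar\varepsilon^{2/3}\Big(1+\log\frac1{\bar\varepsilon}\Big)^k + C\,T^{-1/3}(1+\log T)^k$$ (the first term is read as $0$ if $\bar\varepsilon=0$). In particular the loss is $\tilde O(\bar\varepsilon^{2/3})$, where $\tilde O(f)$ stands for $O(f)\,\mathrm{polylog}(1/\bar\varepsilon)+o(1)$, with $o(1)\to0$ as $T\to\infty$ uniformly in the rates and the buyer. 2. This is tight, even for constant rates that the seller knows: there is a constant $c>0$ such that for all $T\ge1$ and all $\varepsilon>0$ with $T\varepsilon^2\le 1$ there is a stochastic buyer with constant changing rate $\varepsilon$ (so $\bar\varepsilon=\varepsilon$) against which every online pricing algorithm has loss at least $c\,\bar\varepsilon^{2/3}$. -/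

import Mathlib

open MeasureTheory ProbabilityTheory

namespace MovingTarget

/-- Full record of the rounds `0, …, n` (round `0` is the first one): in each round the pair
`(value, price)`, both in `[0, 1]`. -/
abbrev History (n : ℕ) : Type := (i : Finset.Iic n) → unitInterval × unitInterval

/-- What the seller remembers of the rounds `0, …, n`: in each round the posted price and the
bit telling whether the item was sold. -/
abbrev Observation (n : ℕ) : Type := (i : Finset.Iic n) → unitInterval × Bool

/-- The part of the record that the seller observes: the sale bit is `true` iff `price ≤ value`. -/
noncomputable def observe (n : ℕ) (h : History n) : Observation n :=
  fun i => ((h i).2, decide ((h i).2 ≤ (h i).1))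

theorem measurable_observe (n : ℕ) : Measurable (observe n) := by
  refine measurable_pi_lambda _ fun i => ?_
  have h1 : Measurable fun h : History n => (h i).1 := (measurable_pi_apply i).fst
  have h2 : Measurable fun h : History n => (h i).2 := (measurable_pi_apply i).snd
  refine h2.prodMk (measurable_to_bool ?_)
  have : (fun h : History n => decide ((h i).2 ≤ (h i).1)) ⁻¹' {true}
      = {h | (h i).2 ≤ (h i).1} := by
    ext h; simp
  rw [this]
  exact measurableSet_le h2 h1

/-- A (randomized) online pricing algorithm: the distribution of the first price, and the
conditional distribution of the price of round `n + 1` given the seller's own observations in the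
rounds `0, …, n`. -/
structure PricingAlgorithm where
  first : Measure unitInterval
  first_prob : IsProbabilityMeasure first
  next : (n : ℕ) → Kernel (Observation n) unitInterval
  next_markov : ∀ n, IsMarkovKernel (next n)

attribute [instance] PricingAlgorithm.first_prob PricingAlgorithm.next_markov

/-- A stochastic buyer with changing rates `ε 0, ε 1, …`: an adaptive adversary that chooses the
distribution of the first value and, given the values and prices of the rounds `0, …, n`,
the distribution of the value of round `n + 1`, in such a way that the value stays in `[0, 1]`, and
that its increment is supported in `[-ε n, ε n]` and has mean zero. -/
structure StochasticBuyer (ε : ℕ → ℝ) where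
  first : Measure unitInterval
  first_prob : IsProbabilityMeasure first
  next : (n : ℕ) → Kernel (History n) unitInterval
  next_markov : ∀ n, IsMarkovKernel (next n)
  rate : ∀ (n : ℕ) (h : History n),
    ∀ᵐ w : unitInterval ∂(next n h), |(w : ℝ) - ((h ⟨n, Finset.mem_Iic.2 le_rfl⟩).1 : ℝ)| ≤ ε n
  mean_zero : ∀ (n : ℕ) (h : History n),
    ∫ w : unitInterval, ((w : ℝ) - ((h ⟨n, Finset.mem_Iic.2 le_rfl⟩).1 : ℝ)) ∂(next n h) = 0

attribute [instance] StochasticBuyer.first_prob StochasticBuyer.next_markov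

/-- Conditional distribution of the pair `(value, price)` of round `n + 1` given the record of the
rounds `0, …, n`: buyer and seller move simultaneously, hence independently given the past. -/
noncomputable def roundKernel {ε : ℕ → ℝ} (A : PricingAlgorithm) (B : StochasticBuyer ε) (n : ℕ) :
    Kernel (History n) (unitInterval × unitInterval) :=
  B.next n ×ₖ (A.next n).comap (observe n) (measurable_observe n)

instance {ε : ℕ → ℝ} (A : PricingAlgorithm) (B : StochasticBuyer ε) (n : ℕ) :
    IsMarkovKernel (roundKernel A B n) := by
  unfold roundKernel; infer_instance

/-- The law of the whole play `(v₀, p₀), (v₁, p₁), …` of algorithm `A` against buyer `B`. -/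
noncomputable def playLaw {ε : ℕ → ℝ} (A : PricingAlgorithm) (B : StochasticBuyer ε) :
    Measure (ℕ → unitInterval × unitInterval) :=
  Kernel.trajMeasure (X := fun _ => unitInterval × unitInterval)
    (B.first.prod A.first) (roundKernel A B)

/-- Revenue loss of one round: the value minus the revenue, which is the price if the item is sold
(`price ≤ value`) and zero otherwise. -/
noncomputable def roundLoss (v p : unitInterval) : ℝ :=
  (v : ℝ) - (if p ≤ v then (p : ℝ) else 0)

/-- Average revenue loss of a play over the first `T` rounds. -/
noncomputable def revenueLoss (T : ℕ) (ω : ℕ → unitInterval × unitInterval) : ℝ :=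
  (1 / (T : ℝ)) * ∑ t ∈ Finset.range T, roundLoss (ω t).1 (ω t).2

/-- Expected average revenue loss of algorithm `A` against buyer `B` over the first `T` rounds. -/
noncomputable def expectedLoss {ε : ℕ → ℝ} (T : ℕ) (A : PricingAlgorithm)
    (B : StochasticBuyer ε) : ℝ :=
  ∫ ω, revenueLoss T ω ∂(playLaw A B)

/-- The average changing rate over `T` rounds. -/
noncomputable def averageRate (T : ℕ) (ε : ℕ → ℝ) : ℝ :=
  (1 / (T : ℝ)) * ∑ t ∈ Finset.range T, ε t

end MovingTarget

/-! Upper bound. At a constant rate ε, keep a price about 2^(-l) below the value for 2^l ≈ ε^(-2/3)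
rounds. The gap costs about ε^(2/3) per round. Over the block the martingale typically moves by
ε·2^(l/2) ≈ 2^(-l), so a lost sale, which costs at most 1, about once per block is affordable.
`trackingAlgorithm` looks for this l without knowing ε: a completed block is followed by an upward
scan in steps 2^(-l) and a doubling of the block length; a lost sale during a block lowers the price
and halves the length.

The analysis uses a potential `PriceState.pot` in the rescaled gap y = 2^l (v - p). It depends on a
rate class j with ε² 8^j ≤ 1, chosen so that 2^(-j) is of order ε^(2/3) unless j is capped. The key
inequality `PriceState.loss_add_pot_le` says that loss plus new potential is at most old potential
plus 333/2^j plus a term linear in the increment of the value; the martingale property removes the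
linear term. Since the rates decrease, j only grows; each unit of growth costs 21, and j is capped
at log₂ T. Telescoping (`sum_loss_add_potAt_le`) and concavity of x^(2/3) give loss O(ε̄^(2/3) + (1
+ log T)/T), which is more than required, from a deterministic algorithm that ignores T.

Lower bound. The buyer is a random walk with step of order ε. While nothing goes unsold after round
c, the seller learns only "sold", so it behaves like its `ghost`, whose later prices are independent
of the later increments (`lintegral_soldSince_ghost`, `lintegral_ghost`). After N steps the walk has
moved by b ≈ ε√N in either direction with constant probability (`walkOp_iterate_tail`). A price
above v_c - b therefore risks a lost sale, of constant cost, and a lower one risks a loss b. With N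
≈ ε^(-2/3) one has bN ≈ 1, the two risks balance over a window of N rounds, and averaging
`window_bound` over c yields a loss of order b ≈ ε^(2/3) per round. -/

namespace MovingTarget

/-! ### The law of the play, disintegrated one round at a time -/

/-- Infinite record of a play: the pair (value, price) of every round. -/
abbrev Play : Type := ℕ → unitInterval × unitInterval

/-- The record of the rounds `0, …, n` of a play. -/
abbrev recordUpTo (n : ℕ) (ω : Play) : History n := Preorder.frestrictLe n ω

theorem measurable_recordUpTo (n : ℕ) : Measurable (recordUpTo n) := by
  unfold recordUpTo; fun_prop

section Play

variable {ε : ℕ → ℝ} (A : PricingAlgorithm) (B : StochasticBuyer ε)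

instance : IsProbabilityMeasure (playLaw A B) := by
  unfold playLaw; infer_instance

theorem playLaw_map_record_next (n : ℕ) :
    (playLaw A B).map (fun ω => (recordUpTo n ω, ω (n + 1)))
      = (playLaw A B).map (recordUpTo n) ⊗ₘ roundKernel A B n :=
  (Kernel.map_frestrictLe_trajMeasure_compProd_eq_map_trajMeasure
    (X := fun _ => unitInterval × unitInterval)).symm

theorem playLaw_map_zero : (playLaw A B).map (fun ω => ω 0) = B.first.prod A.first := by
  set e := MeasurableEquiv.piUnique (fun _ : Finset.Iic 0 => unitInterval × unitInterval) with he
  have h1 : (fun ω : Play => ω 0) = e ∘ Preorder.frestrictLe 0 := by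
    ext ω <;> rfl
  have h2 : (playLaw A B).map (Preorder.frestrictLe 0) = (B.first.prod A.first).map e.symm := by
    unfold playLaw Kernel.trajMeasure
    rw [Measure.map_comp _ _ (by fun_prop), Kernel.traj_map_frestrictLe, Kernel.partialTraj_self,
      Measure.id_comp]
  rw [h1, ← Measure.map_map e.measurable (by fun_prop), h2,
    Measure.map_map e.measurable e.symm.measurable]
  simp

theorem lintegral_playLaw_succ (n : ℕ) {F : History n × (unitInterval × unitInterval) → ENNReal}
    (hF : Measurable F) :
    ∫⁻ ω, F (recordUpTo n ω, ω (n + 1)) ∂playLaw A B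
      = ∫⁻ ω, ∫⁻ p, ∫⁻ v, F (recordUpTo n ω, (v, p)) ∂B.next n (recordUpTo n ω)
          ∂A.next n (observe n (recordUpTo n ω)) ∂playLaw A B := by
  have hm := measurable_recordUpTo n
  have h1 : ∫⁻ ω, F (recordUpTo n ω, ω (n + 1)) ∂playLaw A B
      = ∫⁻ x, F x ∂(playLaw A B).map (fun ω => (recordUpTo n ω, ω (n + 1))) := by
    rw [lintegral_map hF (hm.prodMk (by fun_prop))]
  rw [h1, playLaw_map_record_next, Measure.lintegral_compProd hF,
    lintegral_map (hF.lintegral_kernel_prod_right') hm]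
  refine lintegral_congr fun ω => ?_
  rw [roundKernel, Kernel.prod_apply, Kernel.comap_apply,
    lintegral_prod_symm' (fun x => F (recordUpTo n ω, x)) (hF.comp measurable_prodMk_left)]

/-- The price of the new round integrates out because it is independent of the new value given the
past. This form suffices for the potential: the state before a round is fixed by earlier sale bits,
so only the value is random. -/
theorem integral_playLaw_succ_value (n : ℕ) {F : History n × unitInterval → ℝ}
    (hF : Measurable F)
    (hi : Integrable (fun ω => F (recordUpTo n ω, (ω (n + 1)).1)) (playLaw A B)) :
    Integrable (fun ω => ∫ v, F (recordUpTo n ω, v) ∂B.next n (recordUpTo n ω)) (playLaw A B) ∧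
    ∫ ω, F (recordUpTo n ω, (ω (n + 1)).1) ∂playLaw A B
      = ∫ ω, ∫ v, F (recordUpTo n ω, v) ∂B.next n (recordUpTo n ω) ∂playLaw A B := by
  have hm := measurable_recordUpTo n
  have hmap : (playLaw A B).map (fun ω => (recordUpTo n ω, (ω (n + 1)).1))
      = (playLaw A B).map (recordUpTo n) ⊗ₘ B.next n := by
    have h1 : (fun ω : Play => (recordUpTo n ω, (ω (n + 1)).1))
        = Prod.map id Prod.fst ∘ fun ω => (recordUpTo n ω, ω (n + 1)) := rfl
    rw [h1, ← Measure.map_map (by fun_prop) (hm.prodMk (by fun_prop)), playLaw_map_record_next,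
      ← Measure.compProd_map measurable_fst]
    congr 1
    rw [roundKernel, ← Kernel.fst_eq, Kernel.fst_prod]
  have hmeas : Measurable fun ω : Play => (recordUpTo n ω, (ω (n + 1)).1) :=
    hm.prodMk (by fun_prop)
  have hi' : Integrable F ((playLaw A B).map (recordUpTo n) ⊗ₘ B.next n) := by
    rw [← hmap]
    exact (integrable_map_measure hF.aestronglyMeasurable hmeas.aemeasurable).2 hi
  have hi2 : Integrable (fun h => ∫ v, F (h, v) ∂B.next n h)
      ((playLaw A B).map (recordUpTo n)) := hi'.integral_compProd
  constructor
  · exact (integrable_map_measure hi2.aestronglyMeasurable hm.aemeasurable).1 hi2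
  · have h3 := integral_map (μ := playLaw A B) hmeas.aemeasurable (f := F) hF.aestronglyMeasurable
    rw [← h3, hmap, Measure.integral_compProd hi',
      integral_map hm.aemeasurable hi2.aestronglyMeasurable]

end Play

/-! ### The potential in rescaled coordinates and its one-round inequalities -/

/-- The ratio between the block length `2 ^ l` of level `l` and the block length `2 ^ j / 16`
which suits the rates `ε ≤ 8 ^ (-j / 2)`. -/
noncomputable def levelRatio (l j : ℕ) : ℝ := 16 * 2 ^ l / 2 ^ j

/-- The part of the potential that measures the distance of the level `l` from the level
suited to the current rate. -/
noncomputable def levelPot (l j : ℕ) : ℝ :=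
  if l + 4 ≤ j then 8 * ((j : ℝ) - (l + 4)) else 9 * (levelRatio l j - 1)

/-- A convex barrier: zero on `[1, ∞)`, quadratic on `[0, 1]`, linear on `(-∞, 0]`. -/
noncomputable def barrier (y : ℝ) : ℝ :=
  if 1 ≤ y then 0 else if 0 ≤ y then (1 - y) ^ 2 else 1 - 2 * y

/-- Reserve that pays for a lost sale. For short blocks it is a smooth barrier, so that mean-zero
steps cost only at second order. For blocks that are too long, halving the block is itself a gain,
and only a gap below `-levelRatio l j / 16` needs a reserve. -/
noncomputable def holdPenalty (l j : ℕ) (y : ℝ) : ℝ :=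
  if l + 4 ≤ j then 13 * barrier y else 26 * max 0 (-(y + levelRatio l j / 16))

noncomputable def scanPenalty (l j : ℕ) (y : ℝ) : ℝ :=
  52 * max 0 (-(y + max (levelRatio l j) 1 / 16))

/-- With t the elapsed fraction of the block: (1 - t) y prepays the gap for the rest of the block,
the second y prepays the scan that follows, 20 t `levelRatio l j` is what the block has saved
towards lengthening, and 1 pays for the lost sale that ends the scan. -/
noncomputable def holdPot (l j : ℕ) (t y : ℝ) : ℝ :=
  levelPot l j + (1 - t) * y + y + holdPenalty l j y + 20 * t * levelRatio l j + 1

noncomputable def scanPot (l j : ℕ) (y : ℝ) : ℝ :=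
  levelPot l j + y + scanPenalty l j y + 20 * levelRatio l j + 1

theorem levelRatio_pos (l j : ℕ) : 0 < levelRatio l j := by unfold levelRatio; positivity

theorem levelRatio_succ_left (l j : ℕ) : levelRatio (l + 1) j = 2 * levelRatio l j := by
  unfold levelRatio; rw [pow_succ]; ring

theorem levelRatio_succ_right (l j : ℕ) : levelRatio l (j + 1) = levelRatio l j / 2 := by
  unfold levelRatio; rw [pow_succ]; field_simp

theorem levelRatio_le_one {l j : ℕ} (h : l + 4 ≤ j) : levelRatio l j ≤ 1 := by
  unfold levelRatio
  rw [div_le_one (by positivity)]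
  calc (16 : ℝ) * 2 ^ l = 2 ^ (l + 4) := by rw [pow_add]; ring
    _ ≤ 2 ^ j := pow_le_pow_right₀ (by norm_num) h

theorem levelRatio_of_eq {l j : ℕ} (h : l + 4 = j) : levelRatio l j = 1 := by
  subst h; unfold levelRatio; rw [pow_add]; field_simp; norm_num

theorem two_le_levelRatio {l j : ℕ} (h : ¬ l + 4 ≤ j) : 2 ≤ levelRatio l j := by
  unfold levelRatio
  rw [le_div_iff₀ (by positivity)]
  calc (2 : ℝ) * 2 ^ j = 2 ^ (j + 1) := by rw [pow_succ]; ring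
    _ ≤ 2 ^ (l + 4) := pow_le_pow_right₀ (by norm_num) (by omega)
    _ = 16 * 2 ^ l := by rw [pow_add]; ring

theorem barrier_nonneg (y : ℝ) : 0 ≤ barrier y := by
  unfold barrier; split_ifs <;> nlinarith

theorem barrier_eq_zero {y : ℝ} (h : 1 ≤ y) : barrier y = 0 := if_pos h

theorem barrier_of_neg {y : ℝ} (h : y < 0) : barrier y = 1 - 2 * y := by
  unfold barrier; rw [if_neg (by linarith), if_neg (by linarith)]

/-- Tangent line plus square: on `[0, ∞)` the slope is -2 max(1 - y, 0), and the barrier is convex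
with curvature at most 2 everywhere. -/
theorem barrier_add_le {y : ℝ} (h : 0 ≤ y) (d : ℝ) :
    barrier (y + d) ≤ barrier y - 2 * max (1 - y) 0 * d + d ^ 2 := by
  unfold barrier
  rcases max_cases (1 - y) 0 with ⟨h1, h2⟩ | ⟨h1, h2⟩ <;> rw [h1] <;> split_ifs <;> nlinarith

/-- The barrier is `2`-Lipschitz, and quadratic near `1`. -/
theorem barrier_le_of_le {y z s : ℝ} (hs : 0 ≤ s) (hz : 1 - s - z ≤ y) (hz0 : 0 ≤ z) :
    barrier y ≤ s ^ 2 + 2 * z := by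
  unfold barrier
  split_ifs with h1 h2
  · nlinarith
  · by_cases hu : 1 - y ≤ s <;> nlinarith
  · nlinarith [sq_nonneg (s - 1)]

theorem barrier_le_neg {y z : ℝ} (hy : y ≤ 0) (hz : y / 2 + 3 / 2 ≤ z) : barrier z ≤ -y := by
  unfold barrier
  split_ifs with h1 h2 <;> nlinarith

theorem barrier_le_neg_two {y z : ℝ} (hy : y ≤ 0) (hz : y + 3 / 2 ≤ z) :
    barrier z ≤ -2 * y := by
  unfold barrier
  split_ifs with h1 h2 <;> nlinarith

theorem barrier_le (y : ℝ) : barrier y ≤ 1 + 2 * max 0 (-y) := by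
  have := le_max_left 0 (-y)
  have := le_max_right 0 (-y)
  unfold barrier; split_ifs <;> nlinarith

/-- Admissible rescaled increments of the value, at level `l`, for the rate class `j`. -/
def SmallStep (l j : ℕ) (d : ℝ) : Prop :=
  |d| ≤ max (levelRatio l j) 1 / 16 ∧ (l + 4 ≤ j → d ^ 2 ≤ 1 / 2 ^ j)

theorem SmallStep.low {l j : ℕ} {d : ℝ} (h : SmallStep l j d) (hl : l + 4 ≤ j) :
    -(1 / 16) ≤ d ∧ d ≤ 1 / 16 := by
  have := h.1
  rw [max_eq_right (levelRatio_le_one hl)] at this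
  exact abs_le.1 this

theorem SmallStep.high {l j : ℕ} {d : ℝ} (h : SmallStep l j d) (hl : ¬ l + 4 ≤ j) :
    -(levelRatio l j / 16) ≤ d ∧ d ≤ levelRatio l j / 16 := by
  have := h.1
  rw [max_eq_left (by linarith [two_le_levelRatio hl])] at this
  exact abs_le.1 this

theorem scanPenalty_of_le {l j : ℕ} {y : ℝ} (h : -(max (levelRatio l j) 1 / 16) ≤ y) :
    scanPenalty l j y = 0 := by
  unfold scanPenalty; rw [max_eq_left (by linarith)]; simp

theorem scanPenalty_nonneg (l j : ℕ) (y : ℝ) : 0 ≤ scanPenalty l j y := by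
  unfold scanPenalty; have := le_max_left 0 (-(y + max (levelRatio l j) 1 / 16)); linarith

theorem holdPenalty_nonneg (l j : ℕ) (y : ℝ) : 0 ≤ holdPenalty l j y := by
  unfold holdPenalty
  have := le_max_left 0 (-(y + levelRatio l j / 16))
  have := barrier_nonneg y
  split_ifs <;> linarith

theorem levelPot_nonneg (l j : ℕ) : 0 ≤ levelPot l j := by
  unfold levelPot
  split_ifs with h
  · have : ((l + 4 : ℕ) : ℝ) ≤ j := by exact_mod_cast h
    push_cast at this; linarith
  · linarith [two_le_levelRatio h]

/-- A sale inside a block. -/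
theorem holdPot_continue (l j : ℕ) {y : ℝ} (hy : 0 ≤ y) (t : ℝ) :
    ∃ s : ℝ, ∀ d, SmallStep l j d →
      y / 2 ^ l + holdPot l j (t + 1 / 2 ^ l) (y + d) ≤ holdPot l j t y + 333 / 2 ^ j + s * d := by
  have hr : levelRatio l j / 2 ^ l = 16 / 2 ^ j := by unfold levelRatio; field_simp
  have h2 : (0 : ℝ) < 1 / 2 ^ j := by positivity
  by_cases hl : l + 4 ≤ j
  -- The loss y / 2^l is the drop of (1 - t) y. Of the budget 333 = 320 + 13, the part 320/2^j feeds
  -- the savings and 13/2^j covers the second-order term 13 d² of the barrier.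
  · refine ⟨(1 - (t + 1 / 2 ^ l)) + 1 - 26 * max (1 - y) 0, fun d hd => ?_⟩
    have hb := barrier_add_le hy d
    have hd2 := hd.2 hl
    unfold holdPot holdPenalty
    rw [if_pos hl, if_pos hl]
    have e1 : 20 * (t + 1 / 2 ^ l) * levelRatio l j
        = 20 * t * levelRatio l j + 320 * (1 / 2 ^ j) := by
      rw [show 320 * (1 / 2 ^ j : ℝ) = 20 * (16 / 2 ^ j) by ring, ← hr]; ring
    have e2 : y / 2 ^ l = 1 / 2 ^ l * y := by ring
    rw [e1, e2, show (333 : ℝ) / 2 ^ j = 320 * (1 / 2 ^ j) + 13 * (1 / 2 ^ j) by ring]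
    nlinarith
  -- From y ≥ 0 a single step stays above -`levelRatio l j` / 16, where the penalty vanishes, so no
  -- second-order term appears.
  · refine ⟨(1 - (t + 1 / 2 ^ l)) + 1, fun d hd => ?_⟩
    have hdd := hd.high hl
    have hp := holdPenalty_nonneg l j y
    have hp2 : holdPenalty l j (y + d) = 0 := by
      unfold holdPenalty; rw [if_neg hl, max_eq_left (by linarith)]; simp
    unfold holdPot
    rw [hp2]
    have e1 : 20 * (t + 1 / 2 ^ l) * levelRatio l j
        = 20 * t * levelRatio l j + 320 * (1 / 2 ^ j) := by
      rw [show 320 * (1 / 2 ^ j : ℝ) = 20 * (16 / 2 ^ j) by ring, ← hr]; ring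
    have e2 : y / 2 ^ l = 1 / 2 ^ l * y := by ring
    rw [e1, e2, show (333 : ℝ) / 2 ^ j = 320 * (1 / 2 ^ j) + 13 * (1 / 2 ^ j) by ring]
    nlinarith

/-- The sale that completes a block. -/
theorem holdPot_complete (l j : ℕ) {y : ℝ} (hy : 0 ≤ y) {d : ℝ} (hd : SmallStep l j d) :
    y / 2 ^ l + scanPot l j (y + d) ≤ holdPot l j (1 - 1 / 2 ^ l) y + 333 / 2 ^ j + d := by
  have hr : levelRatio l j / 2 ^ l = 16 / 2 ^ j := by unfold levelRatio; field_simp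
  have h2 : (0 : ℝ) < 1 / 2 ^ j := by positivity
  have hp := holdPenalty_nonneg l j y
  unfold holdPot scanPot
  rw [scanPenalty_of_le (by linarith [(abs_le.1 hd.1).1])]
  have e1 : 20 * (1 - 1 / 2 ^ l) * levelRatio l j
      = 20 * levelRatio l j - 320 * (1 / 2 ^ j) := by
    rw [show 320 * (1 / 2 ^ j : ℝ) = 20 * (16 / 2 ^ j) by ring, ← hr]; ring
  have e2 : y / 2 ^ l = 1 / 2 ^ l * y := by ring
  rw [e1, e2, show (333 : ℝ) / 2 ^ j = 320 * (1 / 2 ^ j) + 13 * (1 / 2 ^ j) by ring]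
  nlinarith

theorem max_zero_neg_le {a b : ℝ} (h : b ≤ a) : max 0 (-a) ≤ max 0 (-b) :=
  max_le_max le_rfl (by linarith)

/-- A lost sale in a block of level `0`. -/
theorem holdPot_fail_zero (j : ℕ) {y t : ℝ} (hy : y < 0) (ht0 : 0 ≤ t) {d : ℝ}
    (hd : SmallStep 0 j d) :
    1 + holdPot 0 j 0 (y + 2 + d) ≤ holdPot 0 j t y + 333 / 2 ^ j + 2 * d := by
  have hr0 := levelRatio_pos 0 j
  have h2 : (0 : ℝ) < 333 / 2 ^ j := by positivity
  have h20 : 0 ≤ 20 * t * levelRatio 0 j := by positivity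
  have hty : (1 - t) * y ≥ y := by nlinarith
  unfold holdPot holdPenalty
  by_cases hl : 0 + 4 ≤ j
  · rw [if_pos hl, if_pos hl, barrier_of_neg hy]
    have := barrier_le_neg_two hy.le (z := y + 2 + d) (by linarith [(hd.low hl).1])
    nlinarith
  · rw [if_neg hl, if_neg hl]
    -- Here j ≤ 3, so the budget of the single round already covers the lost sale and the lowering
    -- of the price.
    have h1 : (5 : ℝ) ≤ 333 / 2 ^ j := by
      rw [le_div_iff₀ (by positivity)]
      have : (2 : ℝ) ^ j ≤ 2 ^ 3 := pow_le_pow_right₀ (by norm_num) (by omega)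
      linarith
    have h16 : levelRatio 0 j ≤ 16 := by
      unfold levelRatio
      rw [div_le_iff₀ (by positivity)]
      have : (1 : ℝ) ≤ 2 ^ j := one_le_pow₀ (by norm_num)
      linarith
    have := max_zero_neg_le (a := y + 2 + d + levelRatio 0 j / 16) (b := y + levelRatio 0 j / 16)
      (by linarith [(hd.high hl).1])
    nlinarith

/-- A lost sale in a block of positive level. -/
theorem holdPot_fail_succ (l j : ℕ) {y t : ℝ} (hy : y < 0) (ht0 : 0 ≤ t) {d : ℝ}
    (hd : SmallStep (l + 1) j d) :
    1 + holdPot l j 0 (y / 2 + 2 + d / 2) ≤ holdPot (l + 1) j t y + d := by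
  have hr0 := levelRatio_pos (l + 1) j
  have h20 : 0 ≤ 20 * t * levelRatio (l + 1) j := by positivity
  have hty : (1 - t) * y ≥ y := by nlinarith
  unfold holdPot holdPenalty levelPot
  by_cases hl : l + 1 + 4 ≤ j
  · have hl' : l + 4 ≤ j := by omega
    -- At negative gaps the barrier is at least 1, and its weight 13 = 1 + 8 + 4 is what a lost sale
    -- needs: the loss, one more level below the suited one, and twice the price cut of 2 units.
    rw [if_pos hl, if_pos hl, if_pos hl', if_pos hl', barrier_of_neg hy]
    have := barrier_le_neg hy.le (z := y / 2 + 2 + d / 2) (by linarith [(hd.low hl).1])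
    push_cast
    nlinarith
  · rw [if_neg hl, if_neg hl]
    have hm := le_max_right 0 (-(y + levelRatio (l + 1) j / 16))
    have hdd := hd.high hl
    have hr2 := two_le_levelRatio hl
    by_cases hl' : l + 4 ≤ j
    · have hj : l + 4 = j := by omega
      rw [if_pos hl', if_pos hl']
      have hr : levelRatio (l + 1) j = 2 := by
        rw [levelRatio_succ_left, levelRatio_of_eq hj]; norm_num
      rw [hr] at hdd hm ⊢
      have hj' : (j : ℝ) = l + 4 := by rw [← hj]; push_cast; ring
      have := barrier_le_neg hy.le (z := y / 2 + 2 + d / 2) (by linarith)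
      rw [hj']
      nlinarith
    · rw [if_neg hl', if_neg hl']
      rw [levelRatio_succ_left] at *
      have h3 : max 0 (-(y / 2 + 2 + d / 2 + levelRatio l j / 16)) ≤ -y / 2 :=
        max_le (by linarith) (by linarith)
      nlinarith

/-- A sale while scanning. -/
theorem scanPot_continue (l j : ℕ) (y : ℝ) (hy : 1 ≤ y) {d : ℝ} (hd : SmallStep l j d) :
    1 + scanPot l j (y - 1 + d) ≤ scanPot l j y + d := by
  have := scanPenalty_nonneg l j y
  unfold scanPot
  rw [scanPenalty_of_le (y := y - 1 + d) (by linarith [(abs_le.1 hd.1).1])]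
  linarith

/-- The end of a scan. -/
theorem scanPot_complete (l j : ℕ) {y : ℝ} (hy : y < 1) {d : ℝ} (hd : SmallStep l j d) :
    1 + holdPot (l + 1) j 0 (2 * y + 1 + 2 * d) ≤ scanPot l j y + 4 * d := by
  have hr0 := levelRatio_pos l j
  unfold scanPot holdPot holdPenalty levelPot scanPenalty
  have hm0 := le_max_left 0 (-(y + max (levelRatio l j) 1 / 16))
  have hm := le_max_right 0 (-(y + max (levelRatio l j) 1 / 16))
  by_cases hl : l + 1 + 4 ≤ j
  · have hl' : l + 4 ≤ j := by omega
    rw [if_pos hl, if_pos hl, if_pos hl']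
    rw [max_eq_right (levelRatio_le_one hl')] at *
    -- Doubling the resolution turns y ≥ -1/16 into a new gap of at least 3/4, where the barrier is
    -- at most 1/16. A deficit below -1/16 doubles, and the barrier has slope at most 2 in size,
    -- hence the weight 52 = 13·2·2 in `scanPenalty`.
    have := barrier_le_of_le (s := 1 / 4) (z := 2 * max 0 (-(y + 1 / 16)))
      (y := 2 * y + 1 + 2 * d) (by norm_num) (by linarith [(hd.low hl').1]) (by linarith)
    push_cast
    nlinarith
  · rw [if_neg hl, if_neg hl, levelRatio_succ_left]
    have hr1 : 1 ≤ levelRatio l j := by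
      by_cases hl' : l + 4 ≤ j
      · exact (levelRatio_of_eq (by omega)).ge
      · linarith [two_le_levelRatio hl']
    rw [max_eq_left hr1] at *
    have hdd := abs_le.1 hd.1
    rw [max_eq_left hr1] at hdd
    -- With r = `levelRatio l j`, lengthening beyond the suited level costs at most 9r in level
    -- potential and 26r/8 in penalty, besides constants; the 20r saved during the block pays for
    -- it.
    have h3 : max 0 (-(2 * y + 1 + 2 * d + 2 * levelRatio l j / 16))
        ≤ 2 * max 0 (-(y + levelRatio l j / 16)) + levelRatio l j / 8 :=
      max_le (by linarith) (by linarith)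
    have h4 : 9 * (2 * levelRatio l j - 1)
        ≤ (if l + 4 ≤ j then 8 * ((j : ℝ) - (l + 4)) else 9 * (levelRatio l j - 1))
          + 9 * levelRatio l j := by
      split_ifs with hl'
      · have hj : l + 4 = j := by omega
        have hj' : (j : ℝ) = l + 4 := by rw [← hj]; push_cast; ring
        rw [levelRatio_of_eq hj, hj']; linarith
      · linarith
    nlinarith

/-- Price of passing to a slower rate class. The worst case is l + 4 = j + 1, where the penalty
changes from the hinge to the barrier. -/
theorem holdPot_succ_right (l j : ℕ) (y : ℝ) {t : ℝ} (ht0 : 0 ≤ t) :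
    holdPot l (j + 1) t y ≤ holdPot l j t y + 21 := by
  have hr0 := levelRatio_pos l j
  have h20 : 0 ≤ t * levelRatio l j := by positivity
  unfold holdPot holdPenalty levelPot
  rw [levelRatio_succ_right]
  have hm0 := le_max_left 0 (-(y + levelRatio l j / 16))
  have hm := le_max_right 0 (-(y + levelRatio l j / 16))
  by_cases hl : l + 4 ≤ j
  · rw [if_pos hl, if_pos hl, if_pos (by omega), if_pos (by omega)]
    push_cast
    linarith
  · rw [if_neg hl, if_neg hl]
    by_cases hl' : l + 4 ≤ j + 1
    · have hj : l + 4 = j + 1 := by omega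
      have hj' : ((j + 1 : ℕ) : ℝ) = l + 4 := by rw [← hj]; push_cast; ring
      rw [if_pos hl', if_pos hl', hj']
      have hr : levelRatio l j = 2 := by
        have := levelRatio_of_eq hj
        rw [levelRatio_succ_right] at this; linarith
      rw [hr] at hm0 hm h20 ⊢
      have h1 := barrier_le y
      have h3 : max 0 (-y) ≤ max 0 (-(y + 2 / 16)) + 1 / 8 :=
        max_le (by linarith) (by linarith)
      linarith
    · rw [if_neg hl', if_neg hl']
      have h3 : max 0 (-(y + levelRatio l j / 2 / 16))
          ≤ max 0 (-(y + levelRatio l j / 16)) + levelRatio l j / 32 :=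
        max_le (by linarith) (by linarith)
      linarith

theorem scanPot_succ_right (l j : ℕ) (y : ℝ) :
    scanPot l (j + 1) y ≤ scanPot l j y + 21 := by
  have hr0 := levelRatio_pos l j
  unfold scanPot scanPenalty levelPot
  have hm0 := le_max_left 0 (-(y + max (levelRatio l j) 1 / 16))
  have hm := le_max_right 0 (-(y + max (levelRatio l j) 1 / 16))
  by_cases hl : l + 4 ≤ j
  · have hl' : l + 4 ≤ j + 1 := by omega
    rw [if_pos hl, if_pos hl', max_eq_right (levelRatio_le_one hl),
      max_eq_right (levelRatio_le_one hl'), levelRatio_succ_right]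
    push_cast
    linarith
  · have hr2 := two_le_levelRatio hl
    have h1 : max (levelRatio l (j + 1)) 1 = levelRatio l j / 2 := by
      rw [levelRatio_succ_right]; exact max_eq_left (by linarith)
    rw [h1, levelRatio_succ_right, if_neg hl]
    rw [max_eq_left (show 1 ≤ levelRatio l j by linarith)] at *
    have h3 : max 0 (-(y + levelRatio l j / 2 / 16))
        ≤ max 0 (-(y + levelRatio l j / 16)) + levelRatio l j / 32 :=
      max_le (by linarith) (by linarith)
    split_ifs with hl'
    · have hj : l + 4 = j + 1 := by omega
      have hj' : ((j + 1 : ℕ) : ℝ) = l + 4 := by rw [← hj]; push_cast; ring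
      rw [hj']
      linarith
    · linarith

theorem holdPot_nonneg (l j : ℕ) (y : ℝ) {t : ℝ} (ht0 : 0 ≤ t) (ht1 : t ≤ 1) :
    0 ≤ holdPot l j t y := by
  have hr0 := levelRatio_pos l j
  have h20 : 0 ≤ t * levelRatio l j := by positivity
  have hS := levelPot_nonneg l j
  have hP := holdPenalty_nonneg l j y
  unfold holdPot
  rcases le_or_gt 0 y with hy | hy
  · have : 0 ≤ (1 - t) * y := mul_nonneg (by linarith) hy
    linarith
  · have hty : (1 - t) * y ≥ y := by nlinarith
    by_cases hl : l + 4 ≤ j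
    · have : holdPenalty l j y = 13 * (1 - 2 * y) := by
        unfold holdPenalty; rw [if_pos hl, barrier_of_neg hy]
      linarith
    · have h1 : holdPenalty l j y = 26 * max 0 (-(y + levelRatio l j / 16)) := by
        unfold holdPenalty; rw [if_neg hl]
      have h2 : levelPot l j = 9 * (levelRatio l j - 1) := by unfold levelPot; rw [if_neg hl]
      have hm := le_max_right 0 (-(y + levelRatio l j / 16))
      have := two_le_levelRatio hl
      linarith

theorem scanPot_nonneg (l j : ℕ) (y : ℝ) : 0 ≤ scanPot l j y := by
  have hr0 := levelRatio_pos l j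
  have hS := levelPot_nonneg l j
  unfold scanPot scanPenalty
  have hm0 := le_max_left 0 (-(y + max (levelRatio l j) 1 / 16))
  have hm := le_max_right 0 (-(y + max (levelRatio l j) 1 / 16))
  have : max (levelRatio l j) 1 ≤ levelRatio l j + 1 := max_le (by linarith) (by linarith)
  linarith

/-! ### The pricing algorithm as a state machine, and the potential of its states -/

/-- State of the pricing algorithm. In `hold l c p` the price `p` is kept for `2 ^ l` rounds, `c` of
which have passed; in `scan l a` the price is raised by steps `2 ^ (-l)` until a sale is lost. -/
inductive PriceState : Type
  | hold (l c : ℕ) (p : ℝ)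
  | scan (l : ℕ) (a : ℝ)

namespace PriceState

/-- The price the algorithm aims at, before it is clamped to `[0, 1]`. -/
noncomputable def target : PriceState → ℝ
  | hold _ _ p => p
  | scan l a => a + 1 / 2 ^ l

/-- The price that is posted. -/
noncomputable def post (s : PriceState) : unitInterval := Set.projIcc 0 1 zero_le_one s.target

/-- The next state, if the value was at least the target (`true`) or below it (`false`). -/
noncomputable def update : PriceState → Bool → PriceState
  | hold l c p, true => if c + 1 < 2 ^ l then hold l (c + 1) p else scan l p
  | hold l _ p, false => hold (l - 1) 0 (p - 2 / 2 ^ (l - 1))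
  | scan l a, true => scan l (a + 1 / 2 ^ l)
  | scan l a, false => hold (l + 1) 0 (a - 1 / 2 ^ (l + 1))

/-- The next state, given whether the item was sold. -/
noncomputable def advance (s : PriceState) (b : Bool) : PriceState :=
  s.update (b && decide (s.target ≤ 1))

/-- The state before round `n`, given the sale bits. -/
noncomputable def run (b : ℕ → Bool) : ℕ → PriceState
  | 0 => hold 0 0 (-2)
  | n + 1 => (run b n).advance (b n)

def Valid : PriceState → Prop
  | hold l c _ => c < 2 ^ l
  | scan _ _ => True

/-- The potential of a state, for the rate class `j` and the value `v`. -/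
noncomputable def pot (j : ℕ) (v : ℝ) : PriceState → ℝ
  | hold l c p => holdPot l j (c / 2 ^ l) (2 ^ l * (v - p))
  | scan l a => scanPot l j (2 ^ l * (v - a))

theorem Valid.update {s : PriceState} (h : s.Valid) (b : Bool) : (s.update b).Valid := by
  rcases s with ⟨l, c, p⟩ | ⟨l, a⟩ <;> cases b
  · exact Nat.pos_of_neZero _
  · simp only [PriceState.update]
    split_ifs with h1
    · exact h1
    · trivial
  · exact Nat.pos_of_neZero _
  · trivial

theorem run_valid (b : ℕ → Bool) (n : ℕ) : (run b n).Valid := by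
  induction n with
  | zero => exact Nat.one_pos
  | succ n ih => exact ih.update _

theorem run_congr {b b' : ℕ → Bool} {n : ℕ} (h : ∀ i < n, b i = b' i) : run b n = run b' n := by
  induction n with
  | zero => rfl
  | succ n ih =>
    simp only [run]
    rw [ih fun i hi => h i (by omega), h n (by omega)]

theorem pot_nonneg {s : PriceState} (h : s.Valid) (j : ℕ) (v : ℝ) : 0 ≤ s.pot j v := by
  rcases s with ⟨l, c, p⟩ | ⟨l, a⟩
  · refine holdPot_nonneg _ _ _ (by positivity) ?_
    rw [div_le_one (by positivity)]
    exact_mod_cast (show c ≤ 2 ^ l from h.le)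
  · exact scanPot_nonneg _ _ _

theorem pot_add_le (s : PriceState) (j k : ℕ) (v : ℝ) :
    s.pot (j + k) v ≤ s.pot j v + 21 * k := by
  induction k with
  | zero => simp
  | succ k ih =>
    have : s.pot (j + (k + 1)) v ≤ s.pot (j + k) v + 21 := by
      rcases s with ⟨l, c, p⟩ | ⟨l, a⟩
      · exact holdPot_succ_right _ _ _ (by positivity)
      · exact scanPot_succ_right _ _ _
    push_cast
    linarith

/-- Both conditions come from one estimate: the square of the rescaled step is at most 4^l / 8^j =
(`levelRatio l j` / 16)² / 2^j. -/
theorem smallStep_of_rate {l j : ℕ} {e x : ℝ} (he : e ^ 2 * 8 ^ j ≤ 1) (hx : |x| ≤ e) :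
    SmallStep l j (2 ^ l * x) := by
  have hj : (1 : ℝ) ≤ 2 ^ j := one_le_pow₀ (by norm_num)
  have h8 : (8 : ℝ) ^ j = 2 ^ j * 2 ^ j * 2 ^ j := by
    rw [← mul_pow, ← mul_pow]; norm_num
  have hx2 : x ^ 2 * 8 ^ j ≤ 1 := by
    have : x ^ 2 ≤ e ^ 2 := by rw [← sq_abs]; gcongr
    nlinarith [show (0 : ℝ) < 8 ^ j by positivity]
  have key : (2 ^ l * x) ^ 2 ≤ (levelRatio l j / 16) ^ 2 * (1 / 2 ^ j) := by
    have h1 : x ^ 2 ≤ 1 / 8 ^ j := by rw [le_div_iff₀ (by positivity)]; exact hx2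
    have h2 : (levelRatio l j / 16) ^ 2 * (1 / 2 ^ j) = (2 ^ l) ^ 2 * (1 / 8 ^ j) := by
      unfold levelRatio; rw [h8]; field_simp
    rw [h2, mul_pow]
    gcongr
  have hr := levelRatio_pos l j
  have hj1 : 1 / (2 : ℝ) ^ j ≤ 1 := by rw [div_le_one (by positivity)]; exact hj
  have hj0 : 0 ≤ 1 / (2 : ℝ) ^ j := by positivity
  constructor
  · have h3 : |2 ^ l * x| ≤ levelRatio l j / 16 := by
      refine abs_le_of_sq_le_sq (le_trans key ?_) (by positivity)
      nlinarith [sq_nonneg (levelRatio l j / 16)]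
    linarith [le_max_left (levelRatio l j) 1]
  · intro hl
    have := levelRatio_le_one hl
    have h4 : (levelRatio l j / 16) ^ 2 ≤ 1 := by nlinarith
    nlinarith

/-- One round: up to a linear term in the increment of the value, the loss is paid by the decrease
of the potential and the budget `333 / 2 ^ j`. -/
theorem loss_add_pot_le {s : PriceState} (hs : s.Valid) {j : ℕ} {e v L : ℝ}
    (he : e ^ 2 * 8 ^ j ≤ 1) (hL : L ≤ 1) (hL' : s.target ≤ v → L ≤ v - s.target)
    {b : Bool} (hsold : b = true ↔ s.target ≤ v) :
    ∃ a : ℝ, ∀ w : ℝ, |w - v| ≤ e →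
      L + (s.update b).pot j w ≤ s.pot j v + 333 / 2 ^ j + a * (w - v) := by
  have hb : (0 : ℝ) < 333 / 2 ^ j := by positivity
  rcases s with ⟨l, c, p⟩ | ⟨l, x⟩
  · have ht0 : (0 : ℝ) ≤ c / 2 ^ l := by positivity
    simp only [target] at hL' hsold
    by_cases hv : p ≤ v
    · have hy : (0 : ℝ) ≤ 2 ^ l * (v - p) := mul_nonneg (by positivity) (by linarith)
      have hyl : 2 ^ l * (v - p) / 2 ^ l = v - p := by field_simp
      have hLv := hL' hv
      obtain rfl := hsold.2 hv
      simp only [update]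
      split_ifs with hc
      · obtain ⟨a, ha⟩ := holdPot_continue l j hy (c / 2 ^ l)
        refine ⟨a * 2 ^ l, fun w hw => ?_⟩
        have h := ha _ (smallStep_of_rate he hw)
        simp only [pot]
        rw [hyl] at h
        have e1 : ((c + 1 : ℕ) : ℝ) / 2 ^ l = c / 2 ^ l + 1 / 2 ^ l := by push_cast; ring
        have e2 : 2 ^ l * (w - p) = 2 ^ l * (v - p) + 2 ^ l * (w - v) := by ring
        rw [e1, e2]
        linarith
      · refine ⟨2 ^ l, fun w hw => ?_⟩
        have h := holdPot_complete l j hy (smallStep_of_rate he hw)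
        simp only [pot]
        have hc' : c + 1 = 2 ^ l := by
          have : c < 2 ^ l := hs
          omega
        have hc2 : (c : ℝ) + 1 = 2 ^ l := by exact_mod_cast hc'
        have e1 : (c : ℝ) / 2 ^ l = 1 - 1 / 2 ^ l := by
          rw [show (c : ℝ) = 2 ^ l - 1 by linarith]; field_simp
        have e2 : 2 ^ l * (w - p) = 2 ^ l * (v - p) + 2 ^ l * (w - v) := by ring
        rw [hyl] at h
        rw [e1, e2]
        linarith
    · have hy : 2 ^ l * (v - p) < 0 := mul_neg_of_pos_of_neg (by positivity) (by linarith)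
      obtain rfl : b = false := Bool.eq_false_iff.2 fun h => hv (hsold.1 h)
      simp only [update, pot]
      -- At level 0 the truncated subtraction in `update` keeps the level, so the price drops by 2
      -- without a change of scale.
      rcases l with _ | l
      · refine ⟨2, fun w hw => ?_⟩
        have h := holdPot_fail_zero j hy ht0 (smallStep_of_rate he hw)
        simp only [pow_zero, one_mul, Nat.zero_sub, div_one, Nat.cast_zero] at h ⊢
        rw [show w - (p - 2) = v - p + 2 + (w - v) by ring]
        linarith
      · refine ⟨2 ^ (l + 1), fun w hw => ?_⟩
        have h := holdPot_fail_succ l j hy ht0 (smallStep_of_rate he hw)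
        simp only [Nat.add_sub_cancel, Nat.cast_zero, zero_div]
        have e1 : 2 ^ l * (w - (p - 2 / 2 ^ l))
            = 2 ^ (l + 1) * (v - p) / 2 + 2 + 2 ^ (l + 1) * (w - v) / 2 := by
          rw [pow_succ]; field_simp; ring
        rw [e1]
        linarith
  · simp only [target] at hL' hsold
    by_cases hv : x + 1 / 2 ^ l ≤ v
    · have hy : (1 : ℝ) ≤ 2 ^ l * (v - x) := by
        have : (2 : ℝ) ^ l * (1 / 2 ^ l) ≤ 2 ^ l * (v - x) := by gcongr; linarith
        rwa [mul_one_div_cancel (by positivity)] at this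
      obtain rfl := hsold.2 hv
      simp only [update, pot]
      refine ⟨2 ^ l, fun w hw => ?_⟩
      have h := scanPot_continue l j _ hy (smallStep_of_rate he hw)
      have e1 : 2 ^ l * (w - (x + 1 / 2 ^ l)) = 2 ^ l * (v - x) - 1 + 2 ^ l * (w - v) := by
        field_simp; ring
      rw [e1]
      linarith
    · have hy : 2 ^ l * (v - x) < (1 : ℝ) := by
        have : (2 : ℝ) ^ l * (v - x) < 2 ^ l * (1 / 2 ^ l) := by gcongr; linarith
        rwa [mul_one_div_cancel (by positivity)] at this
      obtain rfl : b = false := Bool.eq_false_iff.2 fun h => hv (hsold.1 h)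
      simp only [update, pot]
      refine ⟨4 * 2 ^ l, fun w hw => ?_⟩
      have h := scanPot_complete l j hy (smallStep_of_rate he hw)
      have e1 : 2 ^ (l + 1) * (w - (x - 1 / 2 ^ (l + 1)))
          = 2 * (2 ^ l * (v - x)) + 1 + 2 * (2 ^ l * (w - v)) := by
        rw [pow_succ]; field_simp; ring
      rw [e1]
      simp only [Nat.cast_zero, zero_div]
      linarith

theorem continuous_barrier : Continuous barrier := by
  have : barrier = fun y => (max (1 - max y 0) 0) ^ 2 + 2 * max 0 (-y) := by
    funext y
    unfold barrier
    split_ifs with h1 h2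
    · rw [max_eq_left (by linarith : (0 : ℝ) ≤ y), max_eq_right (by linarith),
        max_eq_left (by linarith)]; ring
    · rw [max_eq_left h2, max_eq_left (by linarith), max_eq_left (by linarith)]; ring
    · rw [max_eq_right (by linarith : y ≤ 0), max_eq_left (by linarith),
        max_eq_right (by linarith)]; ring
  rw [this]
  fun_prop

theorem continuous_pot (s : PriceState) (j : ℕ) : Continuous fun v => s.pot j v := by
  rcases s with ⟨l, c, p⟩ | ⟨l, a⟩
  · have h : Continuous fun y => holdPenalty l j y := by
      unfold holdPenalty
      have := continuous_barrier
      split_ifs <;> fun_prop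
    simp only [pot, holdPot]
    fun_prop
  · simp only [pot, scanPot, scanPenalty]
    fun_prop

/-- Clamping hides nothing. A negative target is posted as 0 and always sells, as it should. A
target above 1 is posted as 1 and could sell at value 1; the conjunct in `advance` discards such a
sale. -/
theorem advance_eq (s : PriceState) (v : unitInterval) :
    s.advance (decide (s.post ≤ v)) = s.update (decide (s.target ≤ (v : ℝ))) := by
  unfold advance
  congr 1
  rw [← Bool.decide_and]
  apply decide_eq_decide.2
  have hv0 := v.2.1
  have hv1 := v.2.2
  rw [← Subtype.coe_le_coe, post, Set.coe_projIcc]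
  constructor
  · rintro ⟨h1, h2⟩
    rw [min_eq_right h2] at h1
    exact (le_max_right _ _).trans h1
  · intro h
    have h2 : s.target ≤ 1 := h.trans hv1
    rw [min_eq_right h2]
    exact ⟨max_le hv0 h, h2⟩

theorem roundLoss_le_one (v p : unitInterval) : roundLoss v p ≤ 1 := by
  unfold roundLoss
  have := v.2.2
  have := p.2.1
  split_ifs <;> linarith

theorem roundLoss_nonneg (v p : unitInterval) : 0 ≤ roundLoss v p := by
  unfold roundLoss
  split_ifs with h
  · have : (p : ℝ) ≤ v := h
    linarith
  · linarith [v.2.1]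

theorem roundLoss_post_le (s : PriceState) (v : unitInterval) (h : s.target ≤ (v : ℝ)) :
    roundLoss v s.post ≤ v - s.target := by
  have h2 : s.target ≤ 1 := h.trans v.2.2
  have hp : (s.post : ℝ) = max 0 s.target := by rw [post, Set.coe_projIcc, min_eq_right h2]
  have hle : s.post ≤ v := by
    rw [← Subtype.coe_le_coe, hp]; exact max_le v.2.1 h
  unfold roundLoss
  rw [if_pos hle, hp]
  linarith [le_max_right 0 s.target]

end PriceState

/-! ### The tracking algorithm in play, and the expected decrease of its potential -/

/-- Extension of the sale bits of the rounds `0, …, n` to all rounds. -/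
def extendBits (n : ℕ) (b : Finset.Iic n → Bool) (i : ℕ) : Bool :=
  if h : i ≤ n then b ⟨i, Finset.mem_Iic.2 h⟩ else false

/-- The sale bits of a play. -/
noncomputable def saleBit (ω : Play) (i : ℕ) : Bool := decide ((ω i).2 ≤ (ω i).1)

theorem run_extendBits (n : ℕ) (ω : Play) :
    PriceState.run (extendBits n fun i => (observe n (recordUpTo n ω) i).2) (n + 1)
      = PriceState.run (saleBit ω) (n + 1) := by
  refine PriceState.run_congr fun i hi => ?_
  unfold extendBits
  rw [dif_pos (show i ≤ n by omega)]
  rfl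

/-- The pricing algorithm that tracks the value by holding a price for blocks of rounds, whose
lengths double after a success and halve after a lost sale. -/
noncomputable def trackingAlgorithm : PricingAlgorithm where
  first := Measure.dirac (PriceState.run (fun _ => false) 0).post
  first_prob := inferInstance
  next n := Kernel.deterministic
    (fun obs => (PriceState.run (extendBits n fun i => (obs i).2) (n + 1)).post)
    ((Measurable.of_discrete (f := fun b : Finset.Iic n → Bool =>
      (PriceState.run (extendBits n b) (n + 1)).post)).comp
        (measurable_pi_lambda _ fun i => (measurable_pi_apply i).snd))
  next_markov _ := inferInstance

section

variable {ε : ℕ → ℝ} (B : StochasticBuyer ε)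

/-- The price kernels are Dirac masses, but the law lives on all sequences of pairs; the state
machine describes the prices only almost surely. -/
theorem ae_price_eq (n : ℕ) :
    ∀ᵐ ω ∂playLaw trackingAlgorithm B, (ω n).2 = (PriceState.run (saleBit ω) n).post := by
  rcases n with _ | n
  · have h := playLaw_map_zero trackingAlgorithm B
    have hm : MeasurableSet {x : unitInterval × unitInterval |
        x.2 = (PriceState.run (fun _ => false) 0).post} :=
      measurableSet_eq_fun measurable_snd measurable_const
    have h2 : ∀ᵐ x ∂(playLaw trackingAlgorithm B).map (fun ω => ω 0),
        x.2 = (PriceState.run (fun _ => false) 0).post := by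
      rw [h]
      refine (Measure.ae_prod_mem_iff_ae_ae_mem hm).2 ?_
      refine Filter.Eventually.of_forall fun x => ?_
      exact (ae_dirac_iff (measurableSet_eq_fun measurable_id measurable_const)).2 rfl
    exact ae_of_ae_map (measurable_pi_apply 0).aemeasurable h2
  · have hobs : Measurable fun h : History n =>
        (PriceState.run (extendBits n fun i => (observe n h i).2) (n + 1)).post :=
      (Measurable.of_discrete (f := fun b : Finset.Iic n → Bool =>
        (PriceState.run (extendBits n b) (n + 1)).post)).comp
          (measurable_pi_lambda _ fun i =>
            ((measurable_pi_apply i).comp (measurable_observe n)).snd)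
    set S : Set (History n × (unitInterval × unitInterval)) :=
      {x | x.2.2 ≠ (PriceState.run (extendBits n fun i => (observe n x.1 i).2) (n + 1)).post}
      with hS
    have hSm : MeasurableSet S :=
      (measurableSet_eq_fun measurable_snd.snd (hobs.comp measurable_fst)).compl
    have key := lintegral_playLaw_succ trackingAlgorithm B n
      (F := S.indicator fun _ => 1) (measurable_const.indicator hSm)
    have hz : ∫⁻ ω, S.indicator (fun _ => 1) (recordUpTo n ω, ω (n + 1))
        ∂playLaw trackingAlgorithm B = 0 := by
      rw [key]
      refine (lintegral_congr fun ω => ?_).trans lintegral_zero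
      have hm2 : Measurable fun p => ∫⁻ v, S.indicator (fun _ => (1 : ENNReal))
          (recordUpTo n ω, (v, p)) ∂B.next n (recordUpTo n ω) := by
        refine Measurable.lintegral_prod_right' (f := fun x : unitInterval × unitInterval =>
          S.indicator (fun _ => (1 : ENNReal)) (recordUpTo n ω, (x.2, x.1))) ?_
        exact (measurable_const.indicator hSm).comp
          (measurable_const.prodMk measurable_swap)
      simp only [trackingAlgorithm]
      rw [Kernel.deterministic_apply, lintegral_dirac' _ hm2]
      refine (lintegral_congr fun v => ?_).trans lintegral_zero
      exact Set.indicator_of_notMem (by simp [hS]) _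
    have hm3 : Measurable fun ω : Play =>
        S.indicator (fun _ => (1 : ENNReal)) (recordUpTo n ω, ω (n + 1)) :=
      (measurable_const.indicator hSm).comp
        ((measurable_recordUpTo n).prodMk (measurable_pi_apply (n + 1)))
    rw [lintegral_eq_zero_iff hm3] at hz
    filter_upwards [hz] with ω hω
    rw [← run_extendBits n ω]
    by_contra hne
    have : (recordUpTo n ω, ω (n + 1)) ∈ S := hne
    simp [Set.indicator_of_mem this] at hω

/-- A function of finitely many sale bits and the value is bounded if it is continuous in the
value. -/
theorem exists_bound_of_finite {β : Type*} [Finite β] {G : β → ℝ → ℝ}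
    (hG : ∀ b, Continuous (G b)) : ∃ C : ℝ, ∀ b, ∀ v : unitInterval, |G b v| ≤ C := by
  have h1 : ∀ b, ∃ C : ℝ, ∀ v : unitInterval, |G b v| ≤ C := fun b => by
    obtain ⟨C, hC⟩ := isCompact_Icc.exists_bound_of_continuousOn (s := Set.Icc (0 : ℝ) 1)
      (hG b).continuousOn
    exact ⟨C, fun v => hC v v.2⟩
  choose C hC using h1
  obtain ⟨D, hD⟩ := (Set.finite_range C).bddAbove
  exact ⟨D, fun b v => (hC b v).trans (hD ⟨b, rfl⟩)⟩

theorem measurable_of_bits {β : Type*} [Countable β] [MeasurableSpace β]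
    [MeasurableSingletonClass β] {G : β → ℝ → ℝ} (hG : ∀ b, Continuous (G b)) :
    Measurable fun x : β × unitInterval => G x.1 x.2 :=
  measurable_from_prod_countable_right fun b =>
    ((hG b).measurable.comp measurable_subtype_coe)

/-- This is where the martingale hypothesis enters: the conditional mean of the linear term is zero,
whatever its coefficient. -/
theorem integral_le_of_linear_bound {ν : Measure unitInterval} [IsProbabilityMeasure ν]
    {v e : ℝ} (hrate : ∀ᵐ w : unitInterval ∂ν, |(w : ℝ) - v| ≤ e)
    (hmean : ∫ w : unitInterval, ((w : ℝ) - v) ∂ν = 0) {f : ℝ → ℝ} (hf : Continuous f)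
    {a b : ℝ} (h : ∀ w : ℝ, |w - v| ≤ e → f w ≤ b + a * (w - v)) :
    ∫ w : unitInterval, f w ∂ν ≤ b := by
  have hi : ∀ g : ℝ → ℝ, Continuous g → Integrable (fun w : unitInterval => g w) ν := by
    intro g hg
    obtain ⟨C, hC⟩ := exists_bound_of_finite (β := Unit) (G := fun _ => g) fun _ => hg
    exact Integrable.of_bound (hg.measurable.comp measurable_subtype_coe).aestronglyMeasurable C
      (Filter.Eventually.of_forall fun w => hC () w)
  calc ∫ w : unitInterval, f w ∂ν ≤ ∫ w : unitInterval, (b + a * ((w : ℝ) - v)) ∂ν := by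
        refine integral_mono_ae (hi f hf) (hi (fun w => b + a * (w - v)) (by fun_prop)) ?_
        filter_upwards [hrate] with w hw using h w hw
    _ = b := by
        rw [integral_add (integrable_const _) (hi (fun w => a * (w - v)) (by fun_prop)),
          integral_const_mul, hmean]
        simp

theorem measurable_roundLoss : Measurable fun x : unitInterval × unitInterval =>
    roundLoss x.1 x.2 := by
  unfold roundLoss
  refine (measurable_subtype_coe.comp measurable_fst).sub (Measurable.ite ?_ ?_ measurable_const)
  · exact measurableSet_le measurable_snd measurable_fst
  · exact measurable_subtype_coe.comp measurable_snd

theorem integrable_roundLoss (A : PricingAlgorithm) (n : ℕ) :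
    Integrable (fun ω : Play => roundLoss (ω n).1 (ω n).2) (playLaw A B) := by
  refine Integrable.of_bound (measurable_roundLoss.comp
    (measurable_pi_apply n)).aestronglyMeasurable 1 (Filter.Eventually.of_forall fun ω => ?_)
  rw [Real.norm_eq_abs, abs_of_nonneg (PriceState.roundLoss_nonneg _ _)]
  exact PriceState.roundLoss_le_one _ _

theorem saleBit_measurable (i : ℕ) : Measurable fun ω : Play => saleBit ω i := by
  refine measurable_to_bool ?_
  have : (fun ω : Play => saleBit ω i) ⁻¹' {true} = {ω | (ω i).2 ≤ (ω i).1} := by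
    ext ω; simp [saleBit]
  rw [this]
  exact measurableSet_le (measurable_pi_apply i).snd (measurable_pi_apply i).fst

/-- The potential before round `n`. -/
noncomputable def potAt (n j : ℕ) (ω : Play) : ℝ :=
  (PriceState.run (saleBit ω) n).pot j (ω n).1

theorem integrable_potAt (A : PricingAlgorithm) (n j : ℕ) :
    Integrable (potAt n j) (playLaw A B) := by
  have hG : ∀ b : Finset.Iic n → Bool,
      Continuous ((PriceState.run (extendBits n b) n).pot j ·) :=
    fun b => PriceState.continuous_pot _ _
  have hb : Measurable fun ω : Play => fun i : Finset.Iic n => saleBit ω i :=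
    measurable_pi_lambda _ fun i => saleBit_measurable i
  have heq : potAt n j = (fun x : (Finset.Iic n → Bool) × unitInterval =>
      (PriceState.run (extendBits n x.1) n).pot j x.2) ∘
        fun ω => ((fun i : Finset.Iic n => saleBit ω i), (ω n).1) := by
    funext ω
    unfold potAt
    simp only [Function.comp]
    congr 1
    refine PriceState.run_congr fun i hi => ?_
    unfold extendBits
    rw [dif_pos hi.le]
  obtain ⟨C, hC⟩ := exists_bound_of_finite hG
  have hm : Measurable (potAt n j) := by
    rw [heq]
    exact (measurable_of_bits hG).comp (hb.prodMk (measurable_pi_apply n).fst)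
  refine Integrable.of_bound hm.aestronglyMeasurable C (Filter.Eventually.of_forall fun ω => ?_)
  rw [heq]
  exact hC _ _

theorem loss_add_potAt_succ_le {n j : ℕ} (hj : ε n ^ 2 * 8 ^ j ≤ 1) :
    ∫ ω, roundLoss (ω n).1 (ω n).2 ∂playLaw trackingAlgorithm B
      + ∫ ω, potAt (n + 1) j ω ∂playLaw trackingAlgorithm B
      ≤ ∫ ω, potAt n j ω ∂playLaw trackingAlgorithm B + 333 / 2 ^ j := by
  set P := playLaw trackingAlgorithm B with hP
  set F : History n × unitInterval → ℝ := fun x =>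
    (PriceState.run (extendBits n fun i => (observe n x.1 i).2) (n + 1)).pot j x.2 with hFdef
  have hF : Measurable F := by
    have h1 : Measurable fun x : History n × unitInterval =>
        ((fun i => (observe n x.1 i).2 : Finset.Iic n → Bool), x.2) := by
      refine Measurable.prodMk (measurable_pi_lambda _ fun i => ?_) measurable_snd
      exact ((measurable_pi_apply i).comp ((measurable_observe n).comp measurable_fst)).snd
    exact (measurable_of_bits (G := fun b : Finset.Iic n → Bool =>
      ((PriceState.run (extendBits n b) (n + 1)).pot j ·))
        fun b => PriceState.continuous_pot _ _).comp h1
  have hFeq : (fun ω : Play => F (recordUpTo n ω, (ω (n + 1)).1)) = potAt (n + 1) j := by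
    funext ω
    simp only [hFdef, potAt, run_extendBits]
  obtain ⟨hi, hI⟩ := integral_playLaw_succ_value trackingAlgorithm B n hF
    (by rw [hFeq]; exact integrable_potAt B _ _ _)
  rw [← hFeq, hI]
  have hL := integrable_roundLoss B trackingAlgorithm n
  rw [← integral_add hL hi]
  have hp := integrable_potAt B trackingAlgorithm n j
  calc ∫ ω, (roundLoss (ω n).1 (ω n).2
        + ∫ v, F (recordUpTo n ω, v) ∂B.next n (recordUpTo n ω)) ∂P
      ≤ ∫ ω, (potAt n j ω + 333 / 2 ^ j) ∂P := by
        refine integral_mono_ae (hL.add hi) (hp.add (integrable_const _)) ?_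
        filter_upwards [ae_price_eq B n] with ω hω
        set s := PriceState.run (saleBit ω) n with hs
        have hsold : saleBit ω n = decide (s.post ≤ (ω n).1) := by
          unfold saleBit; rw [hω]
        have hnext : PriceState.run (saleBit ω) (n + 1)
            = s.update (decide (s.target ≤ ((ω n).1 : ℝ))) := by
          rw [← PriceState.advance_eq, ← hsold]; rfl
        obtain ⟨a, ha⟩ := PriceState.loss_add_pot_le (PriceState.run_valid (saleBit ω) n) hj
          (v := (ω n).1) (PriceState.roundLoss_le_one (ω n).1 s.post)
          (PriceState.roundLoss_post_le s (ω n).1)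
          (b := decide (s.target ≤ ((ω n).1 : ℝ))) decide_eq_true_iff
        have key := integral_le_of_linear_bound (v := (ω n).1) (ν := B.next n (recordUpTo n ω))
          (B.rate n (recordUpTo n ω)) (B.mean_zero n (recordUpTo n ω))
          (PriceState.continuous_pot (PriceState.run (saleBit ω) (n + 1)) j)
          (b := s.pot j (ω n).1 + 333 / 2 ^ j - roundLoss (ω n).1 s.post) (a := a)
          fun w hw => by
            rw [hnext]
            have := ha w hw
            linarith
        simp only [hFdef, run_extendBits]
        rw [hω]
        simp only [potAt]
        linarith
    _ = ∫ ω, potAt n j ω ∂P + 333 / 2 ^ j := by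
        rw [integral_add hp (integrable_const _)]; simp [hP]

end

/-! ### Rate classes and the upper bound -/

/-- The largest `j ≤ J` with `e ≤ 8 ^ (-j / 2)`. -/
noncomputable def rateClass (J : ℕ) (e : ℝ) : ℕ := by
  classical exact Nat.findGreatest (fun j => e ^ 2 * 8 ^ j ≤ 1) J

theorem rateClass_le (J : ℕ) (e : ℝ) : rateClass J e ≤ J := by
  classical exact Nat.findGreatest_le J

theorem rateClass_spec (J : ℕ) {e : ℝ} (h0 : 0 ≤ e) (h1 : e ≤ 1) :
    e ^ 2 * 8 ^ rateClass J e ≤ 1 := by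
  classical
  exact Nat.findGreatest_spec (P := fun j => e ^ 2 * 8 ^ j ≤ 1) (Nat.zero_le J)
    (by rw [pow_zero, mul_one]; exact pow_le_one₀ h0 h1)

theorem rateClass_anti (J : ℕ) {e e' : ℝ} (h0 : 0 ≤ e') (h : e' ≤ e) :
    rateClass J e ≤ rateClass J e' := by
  classical
  refine Nat.findGreatest_mono (fun j hj => le_trans ?_ hj) le_rfl
  gcongr

/-- Below the cap, maximality gives e² 8^(j+1) > 1, and cube roots finish. The second summand
accounts for the cap, which keeps the class finite for vanishing rates. -/
theorem one_div_rateClass_le (J : ℕ) {e : ℝ} (h0 : 0 ≤ e) :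
    1 / (2 : ℝ) ^ rateClass J e ≤ 2 * e ^ (2 / 3 : ℝ) + 1 / 2 ^ J := by
  classical
  have hx0 : 0 ≤ e ^ (2 / 3 : ℝ) := Real.rpow_nonneg h0 _
  rcases (rateClass_le J e).eq_or_lt with h | h
  · rw [h]; linarith
  · have h1 : ¬ e ^ 2 * 8 ^ (rateClass J e + 1) ≤ 1 :=
      Nat.findGreatest_is_greatest (P := fun j => e ^ 2 * 8 ^ j ≤ 1) (Nat.lt_succ_self _) h
    set j := rateClass J e
    set x := e ^ (2 / 3 : ℝ) with hx
    have hx3 : x ^ 3 = e ^ 2 := by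
      rw [hx, ← Real.rpow_natCast, ← Real.rpow_mul h0, ← Real.rpow_natCast]; norm_num
    have h2 : 1 < (x * 2 ^ (j + 1)) ^ 3 := by
      have h8 : (8 : ℝ) ^ (j + 1) = (2 ^ (j + 1)) ^ 3 := by
        rw [← pow_mul, mul_comm, pow_mul]; norm_num
      rw [mul_pow, hx3, ← h8]; exact not_le.1 h1
    have h3 : 1 < x * 2 ^ (j + 1) := by
      by_contra hc
      exact absurd (pow_le_one₀ (n := 3) (by positivity) (not_lt.1 hc)) (not_le.2 h2)
    have h4 : 1 / (2 : ℝ) ^ j ≤ 2 * x := by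
      rw [div_le_iff₀ (by positivity)]
      rw [pow_succ] at h3; linarith
    have : (0 : ℝ) ≤ 1 / 2 ^ J := by positivity
    linarith

/-- The fictitious starting price -2 puts the gap in [2, 3], where all penalties vanish; 142 = 9·15
+ 2·3 + 1. -/
theorem potAt_zero_le (j : ℕ) (ω : Play) : potAt 0 j ω ≤ 8 * j + 142 := by
  have hv0 := (ω 0).1.2.1
  have hv1 := (ω 0).1.2.2
  have hr := levelRatio_pos 0 j
  simp only [potAt, PriceState.run, PriceState.pot, holdPot]
  have hy : 2 ≤ (2 : ℝ) ^ 0 * (((ω 0).1 : ℝ) - -2) ∧ (2 : ℝ) ^ 0 * (((ω 0).1 : ℝ) - -2) ≤ 3 := by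
    constructor <;> rw [pow_zero] <;> linarith
  set y := (2 : ℝ) ^ 0 * (((ω 0).1 : ℝ) - -2)
  have hpen : holdPenalty 0 j y = 0 := by
    unfold holdPenalty
    rw [barrier_eq_zero (by linarith), max_eq_left (by linarith)]
    simp
  have hlev : levelPot 0 j ≤ 8 * j + 135 := by
    unfold levelPot
    have h16 : levelRatio 0 j ≤ 16 := by
      unfold levelRatio
      rw [div_le_iff₀ (by positivity)]
      have : (1 : ℝ) ≤ 2 ^ j := one_le_pow₀ (by norm_num)
      linarith
    have : (0 : ℝ) ≤ j := Nat.cast_nonneg j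
    split_ifs
    · push_cast; linarith
    · linarith
  rw [hpen]
  simp only [Nat.cast_zero, zero_div]
  linarith

section

variable {ε : ℕ → ℝ} (B : StochasticBuyer ε)

/-- Telescoping of the one-round inequality. Monotone rates make the class nondecreasing, so the
total cost of its changes is bounded by 21 times its current value. -/
theorem sum_loss_add_potAt_le (hε : Antitone ε) (h01 : ∀ t, 0 ≤ ε t ∧ ε t ≤ 1) (J n : ℕ) :
    ∑ t ∈ Finset.range n, ∫ ω, roundLoss (ω t).1 (ω t).2 ∂playLaw trackingAlgorithm B
      + ∫ ω, potAt n (rateClass J (ε n)) ω ∂playLaw trackingAlgorithm B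
      ≤ 142 + 21 * (rateClass J (ε n) : ℝ) + 8 * J
        + ∑ t ∈ Finset.range n, 333 / (2 : ℝ) ^ rateClass J (ε t) := by
  induction n with
  | zero =>
    simp only [Finset.range_zero, Finset.sum_empty]
    have h1 : ∫ ω, potAt 0 (rateClass J (ε 0)) ω ∂playLaw trackingAlgorithm B
        ≤ ∫ _, (8 * (rateClass J (ε 0) : ℝ) + 142) ∂playLaw trackingAlgorithm B :=
      integral_mono (integrable_potAt B _ _ _) (integrable_const _) fun ω => potAt_zero_le _ ω
    have h2 : ((rateClass J (ε 0) : ℕ) : ℝ) ≤ J := by exact_mod_cast rateClass_le J (ε 0)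
    have h3 : (0 : ℝ) ≤ rateClass J (ε 0) := Nat.cast_nonneg _
    simp only [integral_const, probReal_univ, one_smul] at h1
    linarith
  | succ n ih =>
    rw [Finset.sum_range_succ, Finset.sum_range_succ]
    have h1 := loss_add_potAt_succ_le B (rateClass_spec J (h01 n).1 (h01 n).2)
    obtain ⟨k, hk⟩ := Nat.exists_eq_add_of_le
      (rateClass_anti J (h01 (n + 1)).1 (hε (Nat.le_succ n)))
    have h2 : ∫ ω, potAt (n + 1) (rateClass J (ε (n + 1))) ω ∂playLaw trackingAlgorithm B
        ≤ ∫ ω, (potAt (n + 1) (rateClass J (ε n)) ω + 21 * (k : ℝ))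
            ∂playLaw trackingAlgorithm B := by
      refine integral_mono (integrable_potAt B _ _ _)
        ((integrable_potAt B _ _ _).add (integrable_const _)) fun ω => ?_
      simp only [potAt]
      rw [hk]
      exact PriceState.pot_add_le _ _ _ _
    rw [integral_add (integrable_potAt B _ _ _) (integrable_const _)] at h2
    simp only [integral_const, probReal_univ, one_smul] at h2
    have h3 : ((rateClass J (ε (n + 1)) : ℕ) : ℝ) = rateClass J (ε n) + k := by
      exact_mod_cast hk
    rw [h3] at *
    linarith

theorem expectedLoss_eq (A : PricingAlgorithm) (T : ℕ) :
    expectedLoss T A B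
      = (1 / (T : ℝ)) * ∑ t ∈ Finset.range T,
          ∫ ω, roundLoss (ω t).1 (ω t).2 ∂playLaw A B := by
  unfold expectedLoss revenueLoss
  rw [integral_const_mul, integral_finsetSum _ fun t _ => integrable_roundLoss B A t]

end

/-- Jensen's inequality for the concave function x^(2/3) and uniform weights. -/
theorem sum_rpow_le {T : ℕ} (hT : 1 ≤ T) {ε : ℕ → ℝ} (h0 : ∀ t, 0 ≤ ε t) :
    ∑ t ∈ Finset.range T, ε t ^ (2 / 3 : ℝ) ≤ T * averageRate T ε ^ (2 / 3 : ℝ) := by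
  have hT0 : (0 : ℝ) < T := by exact_mod_cast hT
  have h := (Real.concaveOn_rpow (p := 2 / 3) (by norm_num) (by norm_num)).le_map_sum
    (t := Finset.range T) (w := fun _ => 1 / (T : ℝ)) (p := ε) (fun _ _ => by positivity)
    (by simp; field_simp) (fun t _ => h0 t)
  simp only [smul_eq_mul, ← Finset.mul_sum] at h
  unfold averageRate
  calc _ = T * (1 / (T : ℝ) * ∑ t ∈ Finset.range T, ε t ^ (2 / 3 : ℝ)) := by field_simp
    _ ≤ _ := by gcongr

theorem averageRate_mem {T : ℕ} (hT : 1 ≤ T) {ε : ℕ → ℝ} (h01 : ∀ t, 0 ≤ ε t ∧ ε t ≤ 1) :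
    0 ≤ averageRate T ε ∧ averageRate T ε ≤ 1 := by
  have hT0 : (0 : ℝ) < T := by exact_mod_cast hT
  unfold averageRate
  constructor
  · exact mul_nonneg (by positivity) (Finset.sum_nonneg fun t _ => (h01 t).1)
  · have : ∑ t ∈ Finset.range T, ε t ≤ T := by
      calc _ ≤ ∑ t ∈ Finset.range T, (1 : ℝ) := Finset.sum_le_sum fun t _ => (h01 t).2
        _ = T := by simp
    rw [one_div, inv_mul_le_iff₀ hT0]; linarith

theorem expectedLoss_trackingAlgorithm_le {T : ℕ} (hT : 1 ≤ T) {ε : ℕ → ℝ} (hε : Antitone ε)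
    (h01 : ∀ t, 0 ≤ ε t ∧ ε t ≤ 1) (B : StochasticBuyer ε) :
    expectedLoss T trackingAlgorithm B ≤
      808 * averageRate T ε ^ (2 / 3 : ℝ) + 808 * ((1 + Real.log T) / T) := by
  have hT0 : (0 : ℝ) < T := by exact_mod_cast hT
  have hT1 : (1 : ℝ) ≤ T := by exact_mod_cast hT
  set J := Nat.log 2 T with hJ
  have hJ1 : 1 / (2 : ℝ) ^ J ≤ 2 / T := by
    rw [div_le_div_iff₀ (by positivity) hT0]
    have : T < 2 ^ (J + 1) := Nat.lt_pow_succ_log_self (by norm_num) T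
    have : (T : ℝ) < 2 ^ (J + 1) := by exact_mod_cast this
    rw [pow_succ] at this
    linarith
  have hlog0 : 0 ≤ Real.log T := Real.log_nonneg hT1
  have hJ2 : (J : ℝ) ≤ 2 * Real.log T := by
    have h1 : 2 ^ J ≤ T := Nat.pow_log_le_self 2 (by omega)
    have h2 : ((2 : ℝ) ^ J) ≤ T := by exact_mod_cast h1
    have h3 := Real.log_le_log (by positivity) h2
    rw [Real.log_pow] at h3
    have : (0 : ℝ) ≤ J := Nat.cast_nonneg J
    nlinarith [Real.log_two_gt_d9]
  have h1 := sum_loss_add_potAt_le B hε h01 J T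
  have h2 : 0 ≤ ∫ ω, potAt T (rateClass J (ε T)) ω ∂playLaw trackingAlgorithm B :=
    integral_nonneg fun ω => PriceState.pot_nonneg (PriceState.run_valid _ _) _ _
  have h3 : ((rateClass J (ε T) : ℕ) : ℝ) ≤ J := by exact_mod_cast rateClass_le J (ε T)
  have h4 : ∑ t ∈ Finset.range T, 333 / (2 : ℝ) ^ rateClass J (ε t)
      ≤ 666 * (T * averageRate T ε ^ (2 / 3 : ℝ)) + 666 := by
    calc _ ≤ ∑ t ∈ Finset.range T, (666 * ε t ^ (2 / 3 : ℝ) + 666 / T) := by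
          refine Finset.sum_le_sum fun t _ => ?_
          have := one_div_rateClass_le J (h01 t).1
          rw [show (333 : ℝ) / 2 ^ rateClass J (ε t) = 333 * (1 / 2 ^ rateClass J (ε t)) by ring,
            show (666 : ℝ) / T = 333 * (2 / T) by ring]
          linarith
      _ = 666 * ∑ t ∈ Finset.range T, ε t ^ (2 / 3 : ℝ) + 666 := by
          rw [Finset.sum_add_distrib, ← Finset.mul_sum, Finset.sum_const, Finset.card_range,
            nsmul_eq_mul]
          field_simp
      _ ≤ _ := by
          have := sum_rpow_le hT fun t => (h01 t).1
          linarith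
  have hx : 0 ≤ averageRate T ε ^ (2 / 3 : ℝ) :=
    Real.rpow_nonneg (averageRate_mem hT h01).1 _
  rw [expectedLoss_eq, one_div, inv_mul_le_iff₀ hT0]
  have h5 : (T : ℝ) * (808 * averageRate T ε ^ (2 / 3 : ℝ) + 808 * ((1 + Real.log T) / T))
      = 808 * (T * averageRate T ε ^ (2 / 3 : ℝ)) + 808 * (1 + Real.log T) := by field_simp
  rw [h5]
  have h6 : 0 ≤ T * averageRate T ε ^ (2 / 3 : ℝ) := by positivity
  linarith

theorem upper_bound {T : ℕ} (hT : 1 ≤ T) {ε : ℕ → ℝ} (hε : Antitone ε)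
    (h01 : ∀ t, 0 ≤ ε t ∧ ε t ≤ 1) (B : StochasticBuyer ε) :
    expectedLoss T trackingAlgorithm B ≤
      808 * (averageRate T ε ^ (2 / 3 : ℝ) * (1 + Real.log (1 / averageRate T ε)) ^ 1) +
        808 * ((T : ℝ) ^ (-(1 / 3) : ℝ) * (1 + Real.log T) ^ 1) := by
  have hT1 : (1 : ℝ) ≤ T := by exact_mod_cast hT
  have hlog0 : 0 ≤ Real.log T := Real.log_nonneg hT1
  obtain ⟨ha0, ha1⟩ := averageRate_mem hT h01
  refine (expectedLoss_trackingAlgorithm_le hT hε h01 B).trans ?_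
  rw [pow_one, pow_one]
  gcongr ?_ + ?_
  · have hx : 0 ≤ averageRate T ε ^ (2 / 3 : ℝ) := Real.rpow_nonneg ha0 _
    have hl : 0 ≤ Real.log (1 / averageRate T ε) := by
      rcases ha0.eq_or_lt with h | h
      -- If the average rate is 0, then 1 / 0 = 0 and `Real.log 0 = 0`, so the logarithm is still
      -- nonnegative.
      · rw [← h]; simp
      · exact Real.log_nonneg (by rw [le_div_iff₀ h]; linarith)
    nlinarith
  · have h1 : 1 / (T : ℝ) ≤ (T : ℝ) ^ (-(1 / 3) : ℝ) := by
      rw [one_div, ← Real.rpow_neg_one]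
      exact Real.rpow_le_rpow_of_exponent_le hT1 (by norm_num)
    have h2 : (1 + Real.log T) / T = 1 / T * (1 + Real.log T) := by ring
    rw [h2]
    gcongr

/-! ### The random-walk buyer -/

/-- The fair coin with outcomes `x` and `y`. -/
noncomputable def fairCoin (x y : unitInterval) : Measure unitInterval :=
  (2⁻¹ : ENNReal) • Measure.dirac x + (2⁻¹ : ENNReal) • Measure.dirac y

instance (x y : unitInterval) : IsProbabilityMeasure (fairCoin x y) :=
  ⟨by simp [fairCoin, ENNReal.inv_two_add_inv_two]⟩

theorem lintegral_fairCoin (x y : unitInterval) (f : unitInterval → ENNReal) :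
    ∫⁻ w, f w ∂fairCoin x y = 2⁻¹ * f x + 2⁻¹ * f y := by
  unfold fairCoin
  rw [lintegral_add_measure, lintegral_smul_measure, lintegral_smul_measure, lintegral_dirac,
    lintegral_dirac, smul_eq_mul, smul_eq_mul]

theorem integral_fairCoin (x y : unitInterval) (f : unitInterval → ℝ) :
    ∫ w, f w ∂fairCoin x y = (f x + f y) / 2 := by
  have h : ∀ z, Integrable f ((2⁻¹ : ENNReal) • Measure.dirac z) := fun z =>
    (integrable_dirac (by simp)).smul_measure (by simp)
  unfold fairCoin
  rw [integral_add_measure (h x) (h y), integral_smul_measure, integral_smul_measure,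
    integral_dirac, integral_dirac]
  simp only [ENNReal.toReal_inv, ENNReal.toReal_ofNat, smul_eq_mul]
  ring

/-- The value `v` moved by `d`, unless it is farther than `1 / 4` from the middle. -/
noncomputable def move (d : ℝ) (v : unitInterval) : unitInterval :=
  if |(v : ℝ) - 1 / 2| ≤ 1 / 4 then Set.projIcc 0 1 zero_le_one ((v : ℝ) + d) else v

theorem measurable_move (d : ℝ) : Measurable (move d) := by
  unfold move
  refine Measurable.ite ?_ ?_ measurable_id
  · exact measurableSet_le (by fun_prop) measurable_const
  · exact (continuous_projIcc.comp (continuous_subtype_val.add continuous_const)).measurable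

theorem coe_move {d : ℝ} (hd : |d| ≤ 1 / 4) {v : unitInterval} (hv : |(v : ℝ) - 1 / 2| ≤ 1 / 4) :
    (move d v : ℝ) = v + d := by
  unfold move
  rw [if_pos hv, Set.coe_projIcc]
  rw [abs_le] at hd hv
  rw [min_eq_right (by linarith), max_eq_right (by linarith)]

theorem move_of_not {d : ℝ} {v : unitInterval} (hv : ¬ |(v : ℝ) - 1 / 2| ≤ 1 / 4) :
    move d v = v := if_neg hv

/-- The value of the last round of a record. -/
def lastValue (n : ℕ) (h : History n) : unitInterval := (h ⟨n, Finset.mem_Iic.2 le_rfl⟩).1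

theorem measurable_lastValue (n : ℕ) : Measurable (lastValue n) := (measurable_pi_apply _).fst

/-- One step of the random walk with step `s`. -/
noncomputable def walkKernel (s : ℝ) : Kernel unitInterval unitInterval where
  toFun v := fairCoin (move s v) (move (-s) v)
  measurable' := by
    refine Measure.measurable_of_measurable_coe _ fun S hS => ?_
    have h : ∀ d, Measurable fun v => (Measure.dirac (move d v)) S := fun d =>
      (Measure.measurable_coe hS).comp (Measure.measurable_dirac.comp (measurable_move d))
    simp only [fairCoin, Measure.add_apply, Measure.smul_apply, smul_eq_mul]
    exact ((h s).const_mul _).add ((h (-s)).const_mul _)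

instance (s : ℝ) : IsMarkovKernel (walkKernel s) :=
  ⟨fun v => inferInstanceAs (IsProbabilityMeasure (fairCoin (move s v) (move (-s) v)))⟩

noncomputable def startLow : unitInterval := ⟨7 / 16, by norm_num, by norm_num⟩
noncomputable def startHigh : unitInterval := ⟨9 / 16, by norm_num, by norm_num⟩

/-- The buyer whose value is a random walk with step `s`, stopped away from the middle. -/
noncomputable def walkBuyer {e s : ℝ} (hs0 : 0 ≤ s) (hs : s ≤ 1 / 8) (hse : s ≤ e) :
    StochasticBuyer (fun _ => e) where
  first := fairCoin startLow startHigh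
  first_prob := inferInstance
  next n := (walkKernel s).comap (lastValue n) (measurable_lastValue n)
  next_markov _ := inferInstance
  rate n h := by
    change ∀ᵐ w : unitInterval ∂fairCoin (move s (lastValue n h)) (move (-s) (lastValue n h)),
      |(w : ℝ) - (lastValue n h : ℝ)| ≤ e
    have key : ∀ d, |d| = s → |(move d (lastValue n h) : ℝ) - (lastValue n h : ℝ)| ≤ e := by
      intro d hd
      by_cases hv : |(lastValue n h : ℝ) - 1 / 2| ≤ 1 / 4
      · rw [coe_move (by rw [hd]; linarith) hv]
        rw [add_sub_cancel_left, hd]; exact hse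
      · rw [move_of_not hv]; simp; linarith
    have hm : MeasurableSet {w : unitInterval | |(w : ℝ) - (lastValue n h : ℝ)| ≤ e} :=
      measurableSet_le (by fun_prop) measurable_const
    unfold fairCoin
    rw [ae_add_measure_iff]
    exact ⟨Measure.ae_smul_measure ((ae_dirac_iff hm).2 (key s (abs_of_nonneg hs0))) _,
      Measure.ae_smul_measure ((ae_dirac_iff hm).2
        (key (-s) (by rw [abs_neg, abs_of_nonneg hs0]))) _⟩
  mean_zero n h := by
    change ∫ w : unitInterval, ((w : ℝ) - (lastValue n h : ℝ))
      ∂fairCoin (move s (lastValue n h)) (move (-s) (lastValue n h)) = 0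
    rw [integral_fairCoin]
    by_cases hv : |(lastValue n h : ℝ) - 1 / 2| ≤ 1 / 4
    · rw [coe_move (by rw [abs_of_nonneg hs0]; linarith) hv,
        coe_move (by rw [abs_neg, abs_of_nonneg hs0]; linarith) hv]
      ring
    · rw [move_of_not hv, move_of_not hv]; ring

/-- The transition operator of the random walk. -/
noncomputable def walkOp (s : ℝ) (f : unitInterval → ENNReal) (v : unitInterval) : ENNReal :=
  2⁻¹ * f (move s v) + 2⁻¹ * f (move (-s) v)

section

variable {e s : ℝ} (hs0 : 0 ≤ s) (hs : s ≤ 1 / 8) (hse : s ≤ e) (A : PricingAlgorithm)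

theorem lintegral_walkBuyer_next (n : ℕ) (h : History n) (f : unitInterval → ENNReal) :
    ∫⁻ v, f v ∂(walkBuyer hs0 hs hse).next n h = walkOp s f (lastValue n h) :=
  lintegral_fairCoin _ _ f

theorem lintegral_value_succ (n : ℕ) {f : unitInterval → ENNReal} (hf : Measurable f) :
    ∫⁻ ω, f (ω (n + 1)).1 ∂playLaw A (walkBuyer hs0 hs hse)
      = ∫⁻ ω, walkOp s f (ω n).1 ∂playLaw A (walkBuyer hs0 hs hse) := by
  have h := lintegral_playLaw_succ A (walkBuyer hs0 hs hse) n
    (F := fun x => f x.2.1) (hf.comp measurable_snd.fst)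
  rw [h]
  refine lintegral_congr fun ω => ?_
  simp only [lintegral_walkBuyer_next]
  rw [lintegral_const, measure_univ, mul_one]
  rfl

theorem lintegral_value_zero {f : unitInterval → ENNReal} (hf : Measurable f) :
    ∫⁻ ω, f (ω 0).1 ∂playLaw A (walkBuyer hs0 hs hse)
      = 2⁻¹ * f startLow + 2⁻¹ * f startHigh := by
  have hg : Measurable fun x : unitInterval × unitInterval => f x.1 := hf.comp measurable_fst
  have h1 : ∫⁻ ω, f (ω 0).1 ∂playLaw A (walkBuyer hs0 hs hse)
      = ∫⁻ x, f x.1 ∂(playLaw A (walkBuyer hs0 hs hse)).map (fun ω => ω 0) := by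
    rw [lintegral_map hg (measurable_pi_apply 0)]
  rw [h1, playLaw_map_zero, lintegral_prod _ hg.aemeasurable]
  simp only [lintegral_const, measure_univ, mul_one]
  exact lintegral_fairCoin _ _ f

/-- The walk moves only while it is at least 1/4, and by at most 1/8. Consequently a lost sale
always costs at least 1/8. -/
theorem ae_value_ge (n : ℕ) :
    ∀ᵐ ω ∂playLaw A (walkBuyer hs0 hs hse), 1 / 8 ≤ ((ω n).1 : ℝ) := by
  set S : Set unitInterval := {v | (v : ℝ) < 1 / 8}
  have hS : MeasurableSet S := measurableSet_lt (by fun_prop) measurable_const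
  have hf : Measurable (S.indicator fun _ => (1 : ENNReal)) := measurable_const.indicator hS
  have hmove : ∀ d, |d| = s → ∀ v, v ∉ S → move d v ∉ S := by
    intro d hd v hv hd2
    have hv' : 1 / 8 ≤ (v : ℝ) := not_lt.1 hv
    have hd3 : (move d v : ℝ) < 1 / 8 := hd2
    by_cases hv : |(v : ℝ) - 1 / 2| ≤ 1 / 4
    · rw [coe_move (by rw [hd]; linarith) hv] at hd3
      have := (abs_le.1 hv).1
      have := (abs_le.1 hd.le).1
      linarith
    · rw [move_of_not hv] at hd3; linarith
  have hz : ∀ n, ∫⁻ ω, S.indicator (fun _ => 1) (ω n).1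
      ∂playLaw A (walkBuyer hs0 hs hse) = 0 := by
    intro n
    induction n with
    | zero =>
      rw [lintegral_value_zero hs0 hs hse A hf, Set.indicator_of_notMem, Set.indicator_of_notMem]
      · simp
      · simp only [S, Set.mem_ofPred_eq, startHigh]; norm_num
      · simp only [S, Set.mem_ofPred_eq, startLow]; norm_num
    | succ n ih =>
      rw [lintegral_value_succ hs0 hs hse A n hf]
      refine le_antisymm (le_trans (lintegral_mono fun ω => ?_) ih.le) zero_le
      unfold walkOp
      by_cases hv : (ω n).1 ∈ S
      · rw [Set.indicator_of_mem hv]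
        have h1 : ∀ v, S.indicator (fun _ => (1 : ENNReal)) v ≤ 1 := fun v =>
          Set.indicator_le_self' (fun _ _ => zero_le) v
        calc _ ≤ 2⁻¹ * 1 + 2⁻¹ * (1 : ENNReal) := by gcongr <;> exact h1 _
          _ = 1 := by simp [ENNReal.inv_two_add_inv_two]
      · rw [Set.indicator_of_notMem (hmove s (abs_of_nonneg hs0) _ hv),
          Set.indicator_of_notMem (hmove (-s) (by rw [abs_neg, abs_of_nonneg hs0]) _ hv)]
        simp
  have h := hz n
  have hm : Measurable fun ω : Play => S.indicator (fun _ => (1 : ENNReal)) (ω n).1 :=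
    hf.comp (measurable_pi_apply n).fst
  rw [lintegral_eq_zero_iff hm] at h
  filter_upwards [h] with ω hω
  by_contra hc
  have : (ω n).1 ∈ S := not_le.1 hc
  simp [Set.indicator_of_mem this] at hω

theorem lintegral_sq_dev_le (n : ℕ) :
    ∫⁻ ω, ENNReal.ofReal ((((ω n).1 : ℝ) - 1 / 2) ^ 2) ∂playLaw A (walkBuyer hs0 hs hse)
      ≤ ENNReal.ofReal (1 / 256 + n * s ^ 2) := by
  have hf : Measurable fun v : unitInterval => ENNReal.ofReal (((v : ℝ) - 1 / 2) ^ 2) := by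
    fun_prop
  induction n with
  | zero =>
    rw [lintegral_value_zero hs0 hs hse A hf]
    have h1 : ((startLow : ℝ) - 1 / 2) ^ 2 = 1 / 256 := by simp only [startLow]; norm_num
    have h2 : ((startHigh : ℝ) - 1 / 2) ^ 2 = 1 / 256 := by simp only [startHigh]; norm_num
    rw [h1, h2, ← add_mul, ENNReal.inv_two_add_inv_two]
    simp
  | succ n ih =>
    rw [lintegral_value_succ hs0 hs hse A n hf]
    calc _ ≤ ∫⁻ ω, (ENNReal.ofReal ((((ω n).1 : ℝ) - 1 / 2) ^ 2) + ENNReal.ofReal (s ^ 2))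
            ∂playLaw A (walkBuyer hs0 hs hse) := by
          refine lintegral_mono fun ω => ?_
          unfold walkOp
          have h2 : (2⁻¹ : ENNReal) = ENNReal.ofReal (1 / 2) := by
            rw [ENNReal.ofReal_div_of_pos (by norm_num)]; simp
          rw [h2, ← ENNReal.ofReal_mul (by norm_num), ← ENNReal.ofReal_mul (by norm_num),
            ← ENNReal.ofReal_add (by positivity) (by positivity),
            ← ENNReal.ofReal_add (by positivity) (by positivity)]
          refine ENNReal.ofReal_le_ofReal ?_
          by_cases hv : |((ω n).1 : ℝ) - 1 / 2| ≤ 1 / 4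
          · rw [coe_move (by rw [abs_of_nonneg hs0]; linarith) hv,
              coe_move (by rw [abs_neg, abs_of_nonneg hs0]; linarith) hv]
            nlinarith
          · rw [move_of_not hv, move_of_not hv]
            nlinarith [sq_nonneg s]
      _ ≤ ENNReal.ofReal (1 / 256 + n * s ^ 2) + ENNReal.ofReal (s ^ 2) := by
          rw [lintegral_add_right _ measurable_const, lintegral_const, measure_univ, mul_one]
          gcongr
      _ = _ := by
          rw [← ENNReal.ofReal_add (by positivity) (by positivity)]
          push_cast
          congr 1
          ring

/-- The value is close to the middle with large probability. -/
theorem prob_near_middle (n : ℕ) (hn : n * s ^ 2 ≤ 1 / 1024) :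
    3 / 4 ≤ (playLaw A (walkBuyer hs0 hs hse)).real
      {ω | |((ω n).1 : ℝ) - 1 / 2| ≤ 3 / 16} := by
  set P := playLaw A (walkBuyer hs0 hs hse)
  set S : Set Play := {ω | |((ω n).1 : ℝ) - 1 / 2| ≤ 3 / 16}
  have hv : Measurable fun ω : Play => ((ω n).1 : ℝ) :=
    measurable_subtype_coe.comp (measurable_pi_apply n).fst
  have hS : MeasurableSet S := measurableSet_le (by fun_prop) measurable_const
  have h1 : P Sᶜ ≤ ENNReal.ofReal (1 / 4) := by
    -- Chebyshev: (1/256 + 1/1024) / (3/16)² = 5/36 ≤ 1/4.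
    have h2 := meas_ge_le_lintegral_div (μ := P)
      (f := fun ω => ENNReal.ofReal ((((ω n).1 : ℝ) - 1 / 2) ^ 2))
      ((hv.sub_const _).pow_const 2).ennreal_ofReal.aemeasurable
      (ε := ENNReal.ofReal (9 / 256)) (by simp) (by simp)
    refine le_trans (measure_mono fun ω hω => ?_) (h2.trans ?_)
    · have h3 : 3 / 16 < |((ω n).1 : ℝ) - 1 / 2| := not_le.1 hω
      refine ENNReal.ofReal_le_ofReal ?_
      rw [← sq_abs]
      nlinarith
    · refine (ENNReal.div_le_div_right (lintegral_sq_dev_le hs0 hs hse A n) _).trans ?_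
      rw [← ENNReal.ofReal_div_of_pos (by norm_num)]
      refine ENNReal.ofReal_le_ofReal ?_
      rw [div_le_iff₀ (by norm_num)]
      linarith
  have h4 : P.real Sᶜ ≤ 1 / 4 := ENNReal.toReal_le_of_le_ofReal (by norm_num) h1
  have h5 : P.real S + P.real Sᶜ = 1 := probReal_add_probReal_compl hS
  linarith

/-- The random start defeats every first price: a price up to 7/16 forgoes at least 1/8 at the high
value, a larger one loses the sale at the low value, and either happens with probability 1/2. This
handles short horizons. -/
theorem first_loss_ge :
    1 / 16 ≤ ∫ ω, roundLoss (ω 0).1 (ω 0).2 ∂playLaw A (walkBuyer hs0 hs hse) := by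
  have hm := measurable_roundLoss
  have h1 : ∫ ω, roundLoss (ω 0).1 (ω 0).2 ∂playLaw A (walkBuyer hs0 hs hse)
      = ∫ x, roundLoss x.1 x.2 ∂(playLaw A (walkBuyer hs0 hs hse)).map (fun ω => ω 0) := by
    rw [integral_map (measurable_pi_apply 0).aemeasurable hm.aestronglyMeasurable]
  have hi : Integrable (fun x : unitInterval × unitInterval => roundLoss x.1 x.2)
      ((walkBuyer hs0 hs hse).first.prod A.first) :=
    Integrable.of_bound hm.aestronglyMeasurable 1 (Filter.Eventually.of_forall fun x => by
      rw [Real.norm_eq_abs, abs_of_nonneg (PriceState.roundLoss_nonneg _ _)]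
      exact PriceState.roundLoss_le_one _ _)
  rw [h1, playLaw_map_zero, integral_prod_symm _ hi]
  have h2 : ∀ p : unitInterval, 1 / 16 ≤ ∫ v, roundLoss v p ∂(walkBuyer hs0 hs hse).first := by
    intro p
    have h3 : ∫ v, roundLoss v p ∂(walkBuyer hs0 hs hse).first
        = (roundLoss startLow p + roundLoss startHigh p) / 2 := integral_fairCoin _ _ _
    rw [h3]
    have hl := PriceState.roundLoss_nonneg startLow p
    have hh := PriceState.roundLoss_nonneg startHigh p
    by_cases hp : p ≤ startLow
    · have hp2 : p ≤ startHigh := hp.trans (by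
        rw [← Subtype.coe_le_coe]; simp only [startLow, startHigh]; norm_num)
      have h4 : roundLoss startHigh p = 9 / 16 - p := by
        unfold roundLoss; rw [if_pos hp2]; rfl
      have : (p : ℝ) ≤ 7 / 16 := hp
      linarith
    · have h4 : roundLoss startLow p = 7 / 16 := by
        unfold roundLoss; rw [if_neg hp, sub_zero]; rfl
      linarith
  calc (1 / 16 : ℝ) = ∫ _, (1 / 16 : ℝ) ∂A.first := by simp
    _ ≤ _ := integral_mono (integrable_const _) hi.integral_prod_right h2

end

/-! ### The ghost algorithm: decoupling prices from values while everything is sold -/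

/-- Extension of a record of the rounds `0, …, n` by the round `n + 1`. -/
def snoc {α : Type*} (n : ℕ) (h : Finset.Iic n → α) (x : α) : Finset.Iic (n + 1) → α :=
  fun i => if hi : i.1 ≤ n then h ⟨i.1, Finset.mem_Iic.2 hi⟩ else x

theorem measurable_snoc {α : Type*} [MeasurableSpace α] (n : ℕ) :
    Measurable fun x : (Finset.Iic n → α) × α => snoc n x.1 x.2 := by
  refine measurable_pi_lambda _ fun i => ?_
  unfold snoc
  split_ifs with hi
  · exact (measurable_pi_apply _).comp measurable_fst
  · exact measurable_snd

theorem recordUpTo_succ (n : ℕ) (ω : Play) :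
    recordUpTo (n + 1) ω = snoc n (recordUpTo n ω) (ω (n + 1)) := by
  funext i
  unfold snoc
  split_ifs with hi
  · rfl
  · have h1 := Finset.mem_Iic.1 i.2
    have h2 : i.1 = n + 1 := by omega
    change ω i.1 = ω (n + 1)
    rw [h2]

/-- What is left of an observation if the sale bits after round `c` are replaced by `true`. -/
def forget (c n : ℕ) (o : Observation n) : Observation n :=
  fun i => if i.1 ≤ c then o i else ((o i).1, true)

theorem measurable_forget (c n : ℕ) : Measurable (forget c n) := by
  refine measurable_pi_lambda _ fun i => ?_
  unfold forget
  split_ifs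
  · exact measurable_pi_apply _
  · exact (measurable_pi_apply _).fst.prodMk measurable_const

theorem forget_observe_snoc {c n : ℕ} (hc : c ≤ n) (h : History n)
    (x : unitInterval × unitInterval) :
    forget c (n + 1) (observe (n + 1) (snoc n h x))
      = snoc n (forget c n (observe n h)) (x.2, true) := by
  funext i
  simp only [forget, observe, snoc]
  by_cases h1 : i.1 ≤ n
  · simp only [dif_pos h1]
  · rw [if_neg (by omega), dif_neg h1, dif_neg h1]

/-- All items of the rounds `c + 1, …, n` have been sold. -/
def soldSince (c n : ℕ) : Set (History n) := {h | ∀ i : Finset.Iic n, c < i.1 → (h i).2 ≤ (h i).1}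

theorem measurableSet_soldSince (c n : ℕ) : MeasurableSet (soldSince c n) := by
  have : soldSince c n = ⋂ i : Finset.Iic n, {h | c < i.1 → (h i).2 ≤ (h i).1} := by
    ext h; simp [soldSince]
  rw [this]
  refine MeasurableSet.iInter fun i => ?_
  by_cases hi : c < i.1
  · simp only [hi, true_imp_iff]
    exact measurableSet_le (measurable_pi_apply i).snd (measurable_pi_apply i).fst
  · simp [hi]

theorem forget_observe {c n : ℕ} {h : History n} (hs : h ∈ soldSince c n) :
    forget c n (observe n h) = observe n h := by
  funext i
  unfold forget
  split_ifs with hi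
  · rfl
  · have := hs i (by omega)
    simp [observe, this]

theorem mem_soldSince_of_snoc {c n : ℕ} {h : History n} {x : unitInterval × unitInterval}
    (hs : snoc n h x ∈ soldSince c (n + 1)) : h ∈ soldSince c n := by
  intro i hi
  have hin := Finset.mem_Iic.1 i.2
  have := hs ⟨i.1, Finset.mem_Iic.2 (by omega)⟩ hi
  simpa only [snoc, dif_pos hin] using this

/-- The algorithm that believes that all items after round `c` are sold. -/
noncomputable def ghost (c : ℕ) (A : PricingAlgorithm) : PricingAlgorithm where
  first := A.first
  first_prob := inferInstance
  next n := (A.next n).comap (forget c n) (measurable_forget c n)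
  next_markov _ := inferInstance

theorem measurable_step {ε : ℕ → ℝ} (A : PricingAlgorithm) (B : StochasticBuyer ε) (n : ℕ)
    {F : History n × (unitInterval × unitInterval) → ENNReal} (hF : Measurable F) :
    Measurable fun h => ∫⁻ p, ∫⁻ v, F (h, (v, p)) ∂B.next n h ∂A.next n (observe n h) := by
  have h1 : Measurable fun h => ∫⁻ x, F (h, x) ∂roundKernel A B n h :=
    hF.lintegral_kernel_prod_right'
  convert h1 using 2 with h
  rw [roundKernel, Kernel.prod_apply, Kernel.comap_apply,
    lintegral_prod_symm' (fun x => F (h, x)) (hF.comp measurable_prodMk_left)]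

/-- As long as no sale is lost after round `c`, the algorithm and its ghost cannot be told apart. -/
theorem lintegral_soldSince_ghost {ε : ℕ → ℝ} (A : PricingAlgorithm) (B : StochasticBuyer ε)
    (c n : ℕ) {F : History n → ENNReal} (hF : Measurable F) :
    ∫⁻ ω, (soldSince c n).indicator F (recordUpTo n ω) ∂playLaw A B
      = ∫⁻ ω, (soldSince c n).indicator F (recordUpTo n ω) ∂playLaw (ghost c A) B := by
  induction n with
  | zero =>
    have h0 : ∀ ω : Play, recordUpTo 0 ω = fun _ => ω 0 := by
      intro ω; funext i
      have h2 : i.1 = 0 := by have := Finset.mem_Iic.1 i.2; omega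
      change ω i.1 = ω 0
      rw [h2]
    have hg : Measurable fun x : unitInterval × unitInterval =>
        (soldSince c 0).indicator F fun _ => x :=
      (hF.indicator (measurableSet_soldSince c 0)).comp (measurable_pi_lambda _ fun _ => measurable_id)
    have h1 : ∀ A' : PricingAlgorithm,
        ∫⁻ ω, (soldSince c 0).indicator F (recordUpTo 0 ω) ∂playLaw A' B
          = ∫⁻ x, (soldSince c 0).indicator F (fun _ => x) ∂(B.first.prod A'.first) := by
      intro A'
      rw [← playLaw_map_zero A' B, lintegral_map hg (measurable_pi_apply 0)]
      simp only [h0]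
    rw [h1, h1]
    rfl
  | succ n ih =>
    have hG : Measurable fun x : History n × (unitInterval × unitInterval) =>
        (soldSince c (n + 1)).indicator F (snoc n x.1 x.2) :=
      (hF.indicator (measurableSet_soldSince c (n + 1))).comp (measurable_snoc n)
    set W : PricingAlgorithm → History n → ENNReal := fun A' h =>
      ∫⁻ p, ∫⁻ v, (soldSince c (n + 1)).indicator F (snoc n h (v, p)) ∂B.next n h
        ∂A'.next n (observe n h) with hW
    have h1 : ∀ A' : PricingAlgorithm,
        ∫⁻ ω, (soldSince c (n + 1)).indicator F (recordUpTo (n + 1) ω) ∂playLaw A' B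
          = ∫⁻ ω, (soldSince c n).indicator (W A') (recordUpTo n ω) ∂playLaw A' B := by
      intro A'
      simp only [recordUpTo_succ]
      rw [lintegral_playLaw_succ A' B n hG]
      refine lintegral_congr fun ω => ?_
      by_cases hs : recordUpTo n ω ∈ soldSince c n
      · rw [Set.indicator_of_mem hs]
      · rw [Set.indicator_of_notMem hs]
        refine (lintegral_congr fun p => (lintegral_congr fun v => ?_).trans lintegral_zero).trans
          lintegral_zero
        exact Set.indicator_of_notMem (fun h => hs (mem_soldSince_of_snoc h)) _
    -- On this event `forget` changes nothing, so both algorithms use the same price kernel; off it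
    -- both sides vanish.
    have h2 : (soldSince c n).indicator (W A) = (soldSince c n).indicator (W (ghost c A)) := by
      refine Set.indicator_congr fun h hs => ?_
      simp only [hW, ghost, Kernel.comap_apply, forget_observe hs]
    rw [h1, h1, ih (measurable_step A B n hG), h2]

section

variable {e s : ℝ} (hs0 : 0 ≤ s) (hs : s ≤ 1 / 8) (hse : s ≤ e) (A : PricingAlgorithm)

theorem measurable_walkOp_param {Q : unitInterval × unitInterval → ENNReal} (hQ : Measurable Q) :
    Measurable fun x : unitInterval × unitInterval => walkOp s (fun v => Q (x.1, v)) x.2 := by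
  have h : ∀ d, Measurable fun x : unitInterval × unitInterval => Q (x.1, move d x.2) := fun d =>
    hQ.comp (measurable_fst.prodMk ((measurable_move d).comp measurable_snd))
  exact ((h s).const_mul _).add ((h (-s)).const_mul _)

theorem measurable_walkOp_iterate (k : ℕ) {Q : unitInterval × unitInterval → ENNReal}
    (hQ : Measurable Q) :
    Measurable fun x : unitInterval × unitInterval =>
      ((walkOp s)^[k] fun v => Q (x.1, v)) x.2 := by
  induction k with
  | zero => exact hQ
  | succ k ih =>
    simp only [Function.iterate_succ_apply']
    exact measurable_walkOp_param ih

/-- Against its ghost, the values after round `c` are independent of the prices. -/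
theorem lintegral_ghost (c k : ℕ) {f : Observation (c + k) × unitInterval → ENNReal}
    (hf : Measurable f) {Q : unitInterval × unitInterval → ENNReal} (hQ : Measurable Q) :
    ∫⁻ ω, f (forget c (c + k) (observe (c + k) (recordUpTo (c + k) ω)), (ω c).1)
        * Q ((ω c).1, (ω (c + k)).1) ∂playLaw (ghost c A) (walkBuyer hs0 hs hse)
      = ∫⁻ ω, f (forget c (c + k) (observe (c + k) (recordUpTo (c + k) ω)), (ω c).1)
        * ((walkOp s)^[k] fun v => Q ((ω c).1, v)) (ω c).1
          ∂playLaw (ghost c A) (walkBuyer hs0 hs hse) := by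
  induction k generalizing Q with
  | zero => rfl
  | succ k ih =>
    set n := c + k with hn
    set B := walkBuyer hs0 hs hse with hB
    have hcn : c ≤ n := by omega
    set f1 : Observation n × unitInterval → ENNReal := fun x =>
      ∫⁻ p, f (snoc n x.1 (p, true), x.2) ∂A.next n x.1 with hf1def
    have hf' : Measurable fun y : (Observation n × unitInterval) × unitInterval =>
        f (snoc n y.1.1 (y.2, true), y.1.2) := by
      refine hf.comp (Measurable.prodMk ?_ measurable_fst.snd)
      exact (measurable_snoc n).comp (measurable_fst.fst.prodMk
        (measurable_snd.prodMk measurable_const))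
    have hf1 : Measurable f1 := by
      have := hf'.lintegral_kernel_prod_right'
        (κ := (A.next n).comap (Prod.fst : Observation n × unitInterval → Observation n)
          measurable_fst)
      simpa only [Kernel.comap_apply] using this
    have step : ∀ {R : unitInterval × unitInterval → ENNReal}, Measurable R →
        ∫⁻ ω, f (forget c (n + 1) (observe (n + 1) (recordUpTo (n + 1) ω)), (ω c).1)
          * R ((ω c).1, (ω (n + 1)).1) ∂playLaw (ghost c A) B
        = ∫⁻ ω, f1 (forget c n (observe n (recordUpTo n ω)), (ω c).1)
          * walkOp s (fun v => R ((ω c).1, v)) (ω n).1 ∂playLaw (ghost c A) B := by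
      intro R hR
      have hcv : Measurable fun h : History n =>
          (h ⟨c, Finset.mem_Iic.2 hcn⟩).1 := (measurable_pi_apply _).fst
      have hF : Measurable fun x : History n × (unitInterval × unitInterval) =>
          f (snoc n (forget c n (observe n x.1)) (x.2.2, true),
            (x.1 ⟨c, Finset.mem_Iic.2 hcn⟩).1)
          * R ((x.1 ⟨c, Finset.mem_Iic.2 hcn⟩).1, x.2.1) := by
        refine Measurable.mul (hf.comp (Measurable.prodMk ?_ (hcv.comp measurable_fst)))
          (hR.comp ((hcv.comp measurable_fst).prodMk measurable_snd.fst))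
        exact (measurable_snoc n).comp ((((measurable_forget c n).comp
          (measurable_observe n)).comp measurable_fst).prodMk
            (measurable_snd.snd.prodMk measurable_const))
      have key := lintegral_playLaw_succ (ghost c A) B n hF
      simp only [recordUpTo_succ, forget_observe_snoc hcn]
      refine Eq.trans key (lintegral_congr fun ω => ?_)
      have h3 : ∀ p, ∫⁻ v, f (snoc n (forget c n (observe n (recordUpTo n ω))) (p, true), (ω c).1)
          * R ((ω c).1, v) ∂B.next n (recordUpTo n ω)
          = f (snoc n (forget c n (observe n (recordUpTo n ω))) (p, true), (ω c).1)
            * walkOp s (fun v => R ((ω c).1, v)) (ω n).1 := by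
        intro p
        have hR' : Measurable fun v => R ((ω c).1, v) := hR.comp measurable_prodMk_left
        rw [lintegral_const_mul _ hR', hB, lintegral_walkBuyer_next]
        rfl
      have h4 : Measurable fun p =>
          f (snoc n (forget c n (observe n (recordUpTo n ω))) (p, true), (ω c).1) :=
        hf'.comp (measurable_prodMk_left (x := (forget c n (observe n (recordUpTo n ω)), (ω c).1)))
      refine Eq.trans (lintegral_congr h3) ?_
      rw [lintegral_mul_const _ h4]
      rfl
    -- The one-round step is applied twice: to Q, and to the iterate of Q evaluated at the value of
    -- round c. The latter ignores the current value and `walkOp` fixes constants, so both sides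
    -- reduce to the same integral with f1 at time n.
    have hid : Measurable fun x : unitInterval × unitInterval =>
        ((walkOp s)^[k + 1] fun v => Q (x.1, v)) x.1 :=
      (measurable_walkOp_iterate (k + 1) hQ).comp (measurable_fst.prodMk measurable_fst)
    have e1 := step hQ
    have e2 := step hid
    have e3 := ih hf1 (measurable_walkOp_param (s := s) hQ)
    have hconst : ∀ (a : ENNReal) (v : unitInterval), walkOp s (fun _ => a) v = a := by
      intro a v
      unfold walkOp
      rw [← add_mul, ENNReal.inv_two_add_inv_two, one_mul]
    simp only [hconst] at e2
    refine e1.trans (e3.trans (Eq.trans ?_ e2.symm))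
    simp only [Function.iterate_succ_apply]

end

/-! ### Anticoncentration of the walk by a fourth-moment argument -/

/-- The transition operator of the simple random walk with step `s` on the line. -/
noncomputable def freeOp (s : ℝ) (g : ℝ → ℝ) (x : ℝ) : ℝ := (g (x + s) + g (x - s)) / 2

theorem freeOp_iterate_quartic (s u α β γ δ : ℝ) (k : ℕ) (x : ℝ) :
    ((freeOp s)^[k] fun x => α * (x - u) ^ 4 + β * (x - u) ^ 2 + γ * (x - u) + δ) x
      = α * (x - u) ^ 4 + (β + 6 * k * α * s ^ 2) * (x - u) ^ 2 + γ * (x - u)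
        + (δ + k * β * s ^ 2 + α * s ^ 4 * (3 * k ^ 2 - 2 * k)) := by
  induction k generalizing x with
  | zero => simp
  | succ k ih =>
    rw [Function.iterate_succ_apply', freeOp, ih, ih]
    push_cast
    ring

/-- Within k steps the walk cannot leave the region where it moves freely, so moments may be
computed on the line. Truncating g at 0 by `ENNReal.ofReal` only helps the inequality. -/
theorem ofReal_freeOp_iterate_le {s : ℝ} (hs0 : 0 ≤ s) (hs : s ≤ 1 / 8) {g : ℝ → ℝ}
    {Q : unitInterval → ENNReal} (hg : ∀ w : unitInterval, ENNReal.ofReal (g w) ≤ Q w) (k : ℕ)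
    {v : unitInterval} (hv : |(v : ℝ) - 1 / 2| + k * s ≤ 1 / 4) :
    ENNReal.ofReal ((freeOp s)^[k] g v) ≤ ((walkOp s)^[k] Q) v := by
  induction k generalizing v with
  | zero => exact hg v
  | succ k ih =>
    push_cast at hv
    have hks : 0 ≤ k * s := by positivity
    have hv4 : |(v : ℝ) - 1 / 2| ≤ 1 / 4 := by linarith
    have e1 := coe_move (d := s) (by rw [abs_of_nonneg hs0]; linarith) hv4
    have e2 := coe_move (d := -s) (by rw [abs_neg, abs_of_nonneg hs0]; linarith) hv4
    have i1 := ih (v := move s v) (by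
      rw [e1]
      have := abs_add_le ((v : ℝ) - 1 / 2) s
      rw [abs_of_nonneg hs0] at this
      rw [show (v : ℝ) + s - 1 / 2 = v - 1 / 2 + s by ring]
      linarith)
    have i2 := ih (v := move (-s) v) (by
      rw [e2]
      have := abs_add_le ((v : ℝ) - 1 / 2) (-s)
      rw [abs_neg, abs_of_nonneg hs0] at this
      rw [show (v : ℝ) + -s - 1 / 2 = v - 1 / 2 + -s by ring]
      linarith)
    rw [Function.iterate_succ_apply', Function.iterate_succ_apply', freeOp, walkOp]
    rw [e1] at i1
    rw [e2, ← sub_eq_add_neg] at i2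
    have h2 : (2⁻¹ : ENNReal) = ENNReal.ofReal (1 / 2) := by
      rw [ENNReal.ofReal_div_of_pos (by norm_num)]; simp
    calc _ = ENNReal.ofReal (1 / 2 * (freeOp s)^[k] g (v + s)
            + 1 / 2 * (freeOp s)^[k] g (v - s)) := by congr 1; ring
      _ ≤ _ := ENNReal.ofReal_add_le
      _ = 2⁻¹ * ENNReal.ofReal ((freeOp s)^[k] g (v + s))
            + 2⁻¹ * ENNReal.ofReal ((freeOp s)^[k] g (v - s)) := by
          rw [ENNReal.ofReal_mul (by norm_num), ENNReal.ofReal_mul (by norm_num), h2]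
      _ ≤ _ := by gcongr

/-- With `quartic_nonpos`, this makes the quartic a minorant of the indicator of z ≤ -1/10, so that
moments up to order four bound a one-sided tail from below. -/
theorem quartic_le_one (z : ℝ) : (-z ^ 4 + 4 * z ^ 2 - 4 * z - 1 / 2) / 12 ≤ 1 := by
  nlinarith [sq_nonneg (z ^ 2 - 3), sq_nonneg (z + 1)]

theorem quartic_nonpos {z : ℝ} (hz : -(1 / 10) < z) :
    (-z ^ 4 + 4 * z ^ 2 - 4 * z - 1 / 2) / 12 ≤ 0 := by
  rcases le_or_gt 0 z with h | h
  · have h1 : 0 ≤ z ^ 3 - 4 * z + 4 := by nlinarith [sq_nonneg (z - 1), sq_nonneg (z - 6 / 5)]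
    nlinarith [mul_nonneg h h1]
  · nlinarith [sq_nonneg (z ^ 2)]

/-- Anticoncentration of the random walk after `N` steps, on either side. -/
theorem walkOp_iterate_tail {s : ℝ} (hs0 : 0 < s) (hs : s ≤ 1 / 8) {N : ℕ} (hN : 1 ≤ N)
    (hNs : N * s ≤ 1 / 16) {σ : ℝ} (hσ : σ ^ 2 = 1) {u : unitInterval}
    (hu : |(u : ℝ) - 1 / 2| ≤ 3 / 16) :
    ENNReal.ofReal (1 / 24) ≤
      ((walkOp s)^[N] ({v : unitInterval | σ * ((v : ℝ) - u) ≤ -(s * √N / 10)}.indicator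
        fun _ => 1)) u := by
  have hN0 : (1 : ℝ) ≤ N := by exact_mod_cast hN
  set r := √(N : ℝ) with hr
  have hr2 : r ^ 2 = N := Real.sq_sqrt (by positivity)
  have hr0 : 0 < r := Real.sqrt_pos.2 (by linarith)
  set g : ℝ → ℝ := fun x => (-(1 / (12 * s ^ 4 * r ^ 4))) * (x - u) ^ 4
    + (4 / (12 * s ^ 2 * r ^ 2)) * (x - u) ^ 2 + (-(4 * σ) / (12 * s * r)) * (x - u)
    + (-(1 / 24)) with hg
  have hgz : ∀ x, g x = (-(σ * (x - u) / (s * r)) ^ 4 + 4 * (σ * (x - u) / (s * r)) ^ 2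
      - 4 * (σ * (x - u) / (s * r)) - 1 / 2) / 12 := by
    intro x
    have hσ4 : σ ^ 4 = 1 := by rw [show σ ^ 4 = (σ ^ 2) ^ 2 by ring, hσ]; norm_num
    simp only [hg, div_pow, mul_pow, hσ, hσ4]
    field_simp
    ring
  have h1 := ofReal_freeOp_iterate_le hs0.le hs (g := g) (k := N) (v := u)
    (Q := {v : unitInterval | σ * ((v : ℝ) - u) ≤ -(s * r / 10)}.indicator fun _ => 1)
    (fun w => by
      rw [hgz]
      by_cases hw : σ * ((w : ℝ) - u) ≤ -(s * r / 10)
      · rw [Set.indicator_of_mem (by exact hw)]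
        exact ENNReal.ofReal_le_one.2 (quartic_le_one _)
      · rw [Set.indicator_of_notMem (by exact hw)]
        refine (ENNReal.ofReal_of_nonpos (quartic_nonpos ?_)).le
        rw [lt_div_iff₀ (by positivity)]
        linarith [not_le.1 hw])
    (by linarith)
  refine le_trans (ENNReal.ofReal_le_ofReal ?_) h1
  rw [hg, freeOp_iterate_quartic]
  -- The normalized walk has second moment 1 and fourth moment 3 - 2/N, so the mean of the quartic
  -- is (1/2 + 2/N)/12.
  have e : -(1 / 24 : ℝ) + N * (4 / (12 * s ^ 2 * r ^ 2)) * s ^ 2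
      + -(1 / (12 * s ^ 4 * r ^ 4)) * s ^ 4 * (3 * (N : ℝ) ^ 2 - 2 * N)
      = 1 / 24 + 1 / (6 * r ^ 2) := by
    rw [← hr2]; field_simp; ring
  rw [e, sub_self]
  have : 0 < 1 / (6 * r ^ 2) := by positivity
  nlinarith

/-! ### The loss in one window of rounds -/

section

variable {e s : ℝ} (hs0 : 0 < s) (hs : s ≤ 1 / 8) (hse : s ≤ e) (A : PricingAlgorithm)

/-- Whatever is known about the ghost's price and the value of round c, the increment since round c
keeps its tail. The sign σ selects the direction. -/
theorem prob_ghost_tail {c N : ℕ} (hN : 1 ≤ N) (hNs : N * s ≤ 1 / 16) {σ : ℝ} (hσ : σ ^ 2 = 1)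
    {E : Set (unitInterval × unitInterval)} (hE : MeasurableSet E)
    (hmid : ∀ x ∈ E, |(x.2 : ℝ) - 1 / 2| ≤ 3 / 16) :
    (playLaw (ghost c A) (walkBuyer hs0.le hs hse)).real {ω | ((ω (c + N)).2, (ω c).1) ∈ E} / 24 ≤
      (playLaw (ghost c A) (walkBuyer hs0.le hs hse)).real
        {ω | ((ω (c + N)).2, (ω c).1) ∈ E ∧
          σ * (((ω (c + N)).1 : ℝ) - (ω c).1) ≤ -(s * √N / 10)} := by
  set P := playLaw (ghost c A) (walkBuyer hs0.le hs hse) with hP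
  set V : Set (unitInterval × unitInterval) :=
    {x | σ * ((x.2 : ℝ) - x.1) ≤ -(s * √N / 10)} with hV
  have hVm : MeasurableSet V := measurableSet_le (by fun_prop) measurable_const
  set f : Observation (c + N) × unitInterval → ENNReal := fun x =>
    E.indicator (fun _ => 1) ((x.1 ⟨c + N, Finset.mem_Iic.2 le_rfl⟩).1, x.2) with hf
  have hproj : Measurable fun ω : Play => ((ω (c + N)).2, (ω c).1) :=
    (measurable_pi_apply _).snd.prodMk (measurable_pi_apply _).fst
  have hproj2 : Measurable fun ω : Play => ((ω c).1, (ω (c + N)).1) :=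
    (measurable_pi_apply _).fst.prodMk (measurable_pi_apply _).fst
  have hfm : Measurable f := by
    refine (measurable_const.indicator hE).comp (Measurable.prodMk ?_ measurable_snd)
    exact ((measurable_pi_apply _).comp measurable_fst).fst
  have key := lintegral_ghost hs0.le hs hse A c N hfm
    (Q := V.indicator fun _ => 1) (measurable_const.indicator hVm)
  have hfe : ∀ ω : Play,
      f (forget c (c + N) (observe (c + N) (recordUpTo (c + N) ω)), (ω c).1)
        = E.indicator (fun _ => 1) ((ω (c + N)).2, (ω c).1) := by
    intro ω
    simp only [hf, forget]
    rw [if_neg (by omega)]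
    rfl
  simp only [hfe] at key
  have hES : MeasurableSet {ω : Play | ((ω (c + N)).2, (ω c).1) ∈ E} := hproj hE
  have hVS : MeasurableSet {ω : Play | ((ω c).1, (ω (c + N)).1) ∈ V} := hproj2 hVm
  have hL : ∫⁻ ω, E.indicator (fun _ => 1) ((ω (c + N)).2, (ω c).1)
      * V.indicator (fun _ => (1 : ENNReal)) ((ω c).1, (ω (c + N)).1) ∂P
      = P {ω | ((ω (c + N)).2, (ω c).1) ∈ E ∧
          σ * (((ω (c + N)).1 : ℝ) - (ω c).1) ≤ -(s * √N / 10)} := by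
    refine Eq.trans ?_ (lintegral_indicator_one (hES.inter hVS))
    refine lintegral_congr fun ω => ?_
    change _ = ({ω : Play | ((ω (c + N)).2, (ω c).1) ∈ E} ∩
      {ω | ((ω c).1, (ω (c + N)).1) ∈ V}).indicator 1 ω
    by_cases h1 : ((ω (c + N)).2, (ω c).1) ∈ E <;>
      by_cases h2 : ((ω c).1, (ω (c + N)).1) ∈ V <;> simp [h1, h2]
  have hR : P {ω | ((ω (c + N)).2, (ω c).1) ∈ E} * ENNReal.ofReal (1 / 24)
      ≤ ∫⁻ ω, E.indicator (fun _ => 1) ((ω (c + N)).2, (ω c).1)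
        * ((walkOp s)^[N] fun v => V.indicator (fun _ => (1 : ENNReal)) ((ω c).1, v)) (ω c).1
          ∂P := by
    rw [← lintegral_indicator_one hES, ← lintegral_mul_const _ (measurable_one.indicator hES)]
    refine lintegral_mono fun ω => ?_
    by_cases h1 : ((ω (c + N)).2, (ω c).1) ∈ E
    · have h3 := walkOp_iterate_tail hs0 hs hN hNs hσ (hmid _ h1)
      rw [Set.indicator_of_mem h1, Set.indicator_of_mem (by exact h1), Pi.one_apply, one_mul,
        one_mul]
      exact h3
    · rw [Set.indicator_of_notMem (by exact h1)]
      simp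
  have hfin := (hR.trans key.symm.le).trans hL.le
  have h4 := ENNReal.toReal_mono (measure_ne_top _ _) hfin
  rw [ENNReal.toReal_mul, ENNReal.toReal_ofReal (by norm_num)] at h4
  simp only [Measure.real]
  linarith

theorem prob_soldSince_ghost {ε : ℕ → ℝ} (B : StochasticBuyer ε) (c n : ℕ) {S : Set (History n)}
    (hS : MeasurableSet S) :
    (playLaw A B).real {ω | recordUpTo n ω ∈ soldSince c n ∩ S}
      = (playLaw (ghost c A) B).real {ω | recordUpTo n ω ∈ soldSince c n ∩ S} := by
  have key := lintegral_soldSince_ghost A B c n (F := S.indicator 1) (measurable_one.indicator hS)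
  have h : ∀ A' : PricingAlgorithm,
      ∫⁻ ω, (soldSince c n).indicator (S.indicator 1) (recordUpTo n ω) ∂playLaw A' B
        = playLaw A' B {ω | recordUpTo n ω ∈ soldSince c n ∩ S} := by
    intro A'
    rw [Set.indicator_indicator]
    exact lintegral_indicator_one
      (measurable_recordUpTo n ((measurableSet_soldSince c n).inter hS))
  rw [h, h] at key
  simp only [Measure.real, key]

/-- The probability of losing a sale is controlled by the losses. -/
theorem prob_not_sold_le (c n : ℕ) :
    (playLaw A (walkBuyer hs0.le hs hse)).real {ω | recordUpTo n ω ∈ soldSince c n}ᶜ ≤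
      8 * ∑ i ∈ Finset.Ioc c n,
        ∫ ω, roundLoss (ω i).1 (ω i).2 ∂playLaw A (walkBuyer hs0.le hs hse) := by
  set B := walkBuyer hs0.le hs hse
  have hm : MeasurableSet {ω : Play | recordUpTo n ω ∈ soldSince c n}ᶜ :=
    (measurable_recordUpTo n (measurableSet_soldSince c n)).compl
  rw [← integral_indicator_one hm, ← integral_finsetSum _ fun i _ => integrable_roundLoss B A i,
    ← integral_const_mul]
  refine integral_mono_ae ((integrable_const (1 : ℝ)).indicator hm)
    ((integrable_finsetSum _ fun i _ => integrable_roundLoss B A i).const_mul 8) ?_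
  filter_upwards [ae_all_iff.2 (ae_value_ge hs0.le hs hse A)] with ω hω
  have hnn : ∀ i ∈ Finset.Ioc c n, 0 ≤ roundLoss (ω i).1 (ω i).2 :=
    fun i _ => PriceState.roundLoss_nonneg _ _
  by_cases hs : recordUpTo n ω ∈ soldSince c n
  · rw [Set.indicator_of_notMem (by simpa using hs)]
    exact mul_nonneg (by norm_num) (Finset.sum_nonneg hnn)
  · rw [Set.indicator_of_mem (by simpa using hs)]
    simp only [soldSince, Set.mem_ofPred_eq, not_forall] at hs
    obtain ⟨i, hci, hi⟩ := hs
    have h1 := Finset.single_le_sum hnn (Finset.mem_Ioc.2 ⟨hci, Finset.mem_Iic.1 i.2⟩)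
    have h2 : roundLoss (ω i.1).1 (ω i.1).2 = (ω i.1).1 := by
      have hi' : ¬ (ω i.1).2 ≤ (ω i.1).1 := hi
      unfold roundLoss
      rw [if_neg hi', sub_zero]
    have h3 := hω i.1
    simp only [Pi.one_apply]
    linarith

/-- The dichotomy: with b = s√N/10, either the ghost's price exceeds v_c - b and a fall of the walk
loses a sale, or it does not and a rise leaves a loss of at least b. The ghost's estimates transfer
to the algorithm on the event that everything is sold. -/
theorem window_bound {c N : ℕ} (hN : 1 ≤ N) (hNs : N * s ≤ 1 / 16)
    (hc : c * s ^ 2 ≤ 1 / 1024) :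
    (s * √N / 10) / 32 ≤
      ∫ ω, roundLoss (ω (c + N)).1 (ω (c + N)).2 ∂playLaw A (walkBuyer hs0.le hs hse)
      + 16 * (s * √N / 10) * ∑ i ∈ Finset.Ioc c (c + N),
        ∫ ω, roundLoss (ω i).1 (ω i).2 ∂playLaw A (walkBuyer hs0.le hs hse) := by
  set B := walkBuyer hs0.le hs hse
  set P := playLaw A B
  set G := playLaw (ghost c A) B
  set b := s * √N / 10 with hb
  have hN0 : (1 : ℝ) ≤ N := by exact_mod_cast hN
  have hb0 : 0 < b := by
    have : 0 < √(N : ℝ) := Real.sqrt_pos.2 (by linarith)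
    positivity
  set t := c + N
  set Sd : Set Play := {ω | recordUpTo t ω ∈ soldSince c t}
  have hSd : MeasurableSet Sd := measurable_recordUpTo t (measurableSet_soldSince c t)
  have hlost : ∀ ω : Play, ω ∈ Sd → (ω t).2 ≤ (ω t).1 := fun ω hω =>
    hω ⟨t, Finset.mem_Iic.2 le_rfl⟩ (show c < c + N by omega)
  have hD := prob_not_sold_le hs0 hs hse A c t
  change P.real Sdᶜ ≤ _ at hD
  have hDG : G.real Sdᶜ = P.real Sdᶜ := by
    have h1 := prob_soldSince_ghost A B c t MeasurableSet.univ
    simp only [Set.inter_univ] at h1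
    have h1' : P.real Sd = G.real Sd := h1
    have h2 : P.real Sd + P.real Sdᶜ = 1 := probReal_add_probReal_compl hSd
    have h3 : G.real Sd + G.real Sdᶜ = 1 := probReal_add_probReal_compl hSd
    linarith
  set E1 : Set (unitInterval × unitInterval) :=
    {x | |(x.2 : ℝ) - 1 / 2| ≤ 3 / 16} ∩ {x | (x.2 : ℝ) - b < x.1}
  set E2 : Set (unitInterval × unitInterval) :=
    {x | |(x.2 : ℝ) - 1 / 2| ≤ 3 / 16} ∩ {x | (x.1 : ℝ) ≤ x.2 - b}
  have hmidm : MeasurableSet {x : unitInterval × unitInterval | |(x.2 : ℝ) - 1 / 2| ≤ 3 / 16} :=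
    measurableSet_le (by fun_prop) measurable_const
  have hE1 : MeasurableSet E1 := hmidm.inter (measurableSet_lt (by fun_prop) (by fun_prop))
  have hE2 : MeasurableSet E2 := hmidm.inter (measurableSet_le (by fun_prop) (by fun_prop))
  have hp1 := prob_ghost_tail hs0 hs hse A (c := c) hN hNs (σ := 1) (by norm_num) hE1
    (fun x hx => hx.1)
  have hp2 := prob_ghost_tail hs0 hs hse A (c := c) hN hNs (σ := -1) (by norm_num) hE2
    (fun x hx => hx.1)
  have hmid := prob_near_middle hs0.le hs hse (ghost c A) c hc
  have hmid2 : 3 / 4 ≤ G.real {ω | ((ω t).2, (ω c).1) ∈ E1}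
      + G.real {ω | ((ω t).2, (ω c).1) ∈ E2} := by
    refine hmid.trans (le_trans (measureReal_mono ?_) (measureReal_union_le _ _))
    intro ω hω
    by_cases h : ((ω c).1 : ℝ) - b < (ω t).2
    · exact Or.inl ⟨hω, h⟩
    · exact Or.inr ⟨hω, not_lt.1 h⟩
  have hq1 : G.real {ω | ((ω t).2, (ω c).1) ∈ E1} / 24 ≤ P.real Sdᶜ := by
    rw [← hDG]
    refine hp1.trans (measureReal_mono ?_)
    rintro ω ⟨h1, h2⟩ h3
    have h4 : ((ω t).2 : ℝ) ≤ (ω t).1 := hlost ω h3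
    have h5 : ((ω c).1 : ℝ) - b < (ω t).2 := h1.2
    linarith
  set S : Set (History t) := {h | ((h ⟨t, Finset.mem_Iic.2 le_rfl⟩).2 : ℝ) + b
    ≤ (h ⟨t, Finset.mem_Iic.2 le_rfl⟩).1}
  have hS : MeasurableSet S := by
    have h1 : Measurable fun h : History t => ((h ⟨t, Finset.mem_Iic.2 le_rfl⟩).1 : ℝ) :=
      measurable_subtype_coe.comp (measurable_pi_apply _).fst
    have h2 : Measurable fun h : History t => ((h ⟨t, Finset.mem_Iic.2 le_rfl⟩).2 : ℝ) :=
      measurable_subtype_coe.comp (measurable_pi_apply _).snd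
    exact measurableSet_le (h2.add_const _) h1
  have hq2 : G.real {ω | ((ω t).2, (ω c).1) ∈ E2} / 24
      ≤ P.real {ω | recordUpTo t ω ∈ soldSince c t ∩ S} + P.real Sdᶜ := by
    rw [prob_soldSince_ghost A B c t hS, ← hDG]
    refine hp2.trans (le_trans (measureReal_mono ?_) (measureReal_union_le _ _))
    rintro ω ⟨h1, h2⟩
    by_cases h3 : ω ∈ Sd
    · refine Or.inl ⟨h3, ?_⟩
      have h5 : ((ω t).2 : ℝ) ≤ (ω c).1 - b := h1.2
      change ((ω t).2 : ℝ) + b ≤ (ω t).1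
      have h2' : -1 * (((ω t).1 : ℝ) - (ω c).1) ≤ -b := h2
      linarith
    · exact Or.inr h3
  have hmarkov : b * P.real {ω | recordUpTo t ω ∈ soldSince c t ∩ S}
      ≤ ∫ ω, roundLoss (ω t).1 (ω t).2 ∂P := by
    refine le_trans ?_ (mul_meas_ge_le_integral_of_nonneg
      (Filter.Eventually.of_forall fun ω => PriceState.roundLoss_nonneg _ _)
      (integrable_roundLoss B A t) b)
    refine mul_le_mul_of_nonneg_left (measureReal_mono ?_) hb0.le
    rintro ω ⟨h1, h2⟩
    have h3 : ((ω t).2 : ℝ) + b ≤ (ω t).1 := h2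
    change b ≤ roundLoss (ω t).1 (ω t).2
    unfold roundLoss
    rw [if_pos (hlost ω h1)]
    linarith
  -- The two cases have total probability at least 3/4, each tail keeps 1/24 of it, and (3/4)/24 =
  -- 1/32. The probability of a lost sale enters twice and is at most 8W, whence the factor 16.
  set W := ∑ i ∈ Finset.Ioc c t, ∫ ω, roundLoss (ω i).1 (ω i).2 ∂P
  have hfin : b * (1 / 32 - 2 * P.real Sdᶜ) ≤ b * P.real {ω | recordUpTo t ω ∈ soldSince c t ∩ S} :=
    mul_le_mul_of_nonneg_left (by linarith) hb0.le
  nlinarith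

end

/-! ### Averaging over windows and the lower bound -/

theorem sum_range_shift_le {L : ℕ → ℝ} (hL : ∀ i, 0 ≤ L i) {M a T : ℕ} (h : a + M ≤ T) :
    ∑ c ∈ Finset.range M, L (a + c) ≤ ∑ i ∈ Finset.range T, L i := by
  have h1 := Finset.sum_range_add L a M
  have h2 : ∑ i ∈ Finset.range (a + M), L i ≤ ∑ i ∈ Finset.range T, L i :=
    Finset.sum_le_sum_of_subset_of_nonneg (Finset.range_mono h) fun i _ _ => hL i
  have h3 : 0 ≤ ∑ i ∈ Finset.range a, L i := Finset.sum_nonneg fun i _ => hL i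
  linarith

/-- Every round lies in at most N of the windows. -/
theorem sum_windows_le {L : ℕ → ℝ} (hL : ∀ i, 0 ≤ L i) {N T : ℕ} (h : N ≤ T) :
    ∑ c ∈ Finset.range (T - N), ∑ i ∈ Finset.Ioc c (c + N), L i
      ≤ N * ∑ i ∈ Finset.range T, L i := by
  have h1 : ∀ c, ∑ i ∈ Finset.Ioc c (c + N), L i = ∑ k ∈ Finset.range N, L (k + 1 + c) := by
    intro c
    have h2 : Finset.Ioc c (c + N) = Finset.Ico (c + 1) (c + 1 + N) := by
      ext i; simp only [Finset.mem_Ioc, Finset.mem_Ico]; omega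
    rw [h2, Finset.sum_Ico_eq_sum_range, Nat.add_sub_cancel_left]
    exact Finset.sum_congr rfl fun k _ => by congr 1; omega
  simp only [h1]
  rw [Finset.sum_comm]
  calc _ ≤ ∑ _k ∈ Finset.range N, ∑ i ∈ Finset.range T, L i := by
        refine Finset.sum_le_sum fun k hk => sum_range_shift_le hL ?_
        have := Finset.mem_range.1 hk
        omega
    _ = _ := by simp

theorem lower_bound {T : ℕ} (hT : 1 ≤ T) {e : ℝ} (he : 0 < e) (hTe : (T : ℝ) * e ^ 2 ≤ 1) :
    ∃ B : StochasticBuyer (fun _ => e), ∀ A : PricingAlgorithm,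
      1 / 30000 * averageRate T (fun _ => e) ^ (2 / 3 : ℝ) ≤ expectedLoss T A B := by
  have hT1 : (1 : ℝ) ≤ T := by exact_mod_cast hT
  have he1 : e ≤ 1 := by
    by_contra hc
    have := not_le.1 hc
    nlinarith
  -- The step e/32 turns T e² ≤ 1 into T s² ≤ 1/1024, which keeps the walk near the middle, and
  -- gives N s ≤ 1/16 below.
  have hs0 : 0 < e / 32 := by positivity
  have hs : e / 32 ≤ 1 / 8 := by linarith
  have hse : e / 32 ≤ e := by linarith
  refine ⟨walkBuyer hs0.le hs hse, fun A => ?_⟩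
  have havg : averageRate T (fun _ => e) = e := by
    unfold averageRate; rw [Finset.sum_const, Finset.card_range, nsmul_eq_mul]; field_simp
  rw [havg, expectedLoss_eq]
  set L : ℕ → ℝ := fun t =>
    ∫ ω, roundLoss (ω t).1 (ω t).2 ∂playLaw A (walkBuyer hs0.le hs hse) with hLdef
  have hL : ∀ i, 0 ≤ L i := fun i => integral_nonneg fun ω => PriceState.roundLoss_nonneg _ _
  set S := ∑ i ∈ Finset.range T, L i
  set x := e ^ (1 / 3 : ℝ) with hx
  have hx0 : 0 < x := Real.rpow_pos_of_pos he _
  have hx1 : x ≤ 1 := Real.rpow_le_one he.le he1 (by norm_num)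
  have hx3 : x ^ 3 = e := by
    rw [hx, ← Real.rpow_natCast, ← Real.rpow_mul he.le]; norm_num
  have hx2 : e ^ (2 / 3 : ℝ) = x ^ 2 := by
    rw [hx, ← Real.rpow_natCast, ← Real.rpow_mul he.le]; norm_num
  rw [hx2]
  -- The window length N ≈ e^(-2/3) makes b comparable to e^(2/3) and bN bounded, so the lost-sale
  -- terms sum to at most S/5.
  set N := ⌈1 / x ^ 2⌉₊ with hN
  have hNl : 1 ≤ N * x ^ 2 := by
    have := Nat.le_ceil (1 / x ^ 2)
    rwa [div_le_iff₀ (by positivity)] at this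
  have hNu : N * x ^ 2 ≤ 2 := by
    have h1 := (Nat.ceil_lt_add_one (a := 1 / x ^ 2) (by positivity)).le
    have h2 : (N : ℝ) * x ^ 2 ≤ (1 / x ^ 2 + 1) * x ^ 2 := by gcongr
    have h3 : (1 / x ^ 2 + 1) * x ^ 2 = 1 + x ^ 2 := by field_simp
    nlinarith
  have hN1 : 1 ≤ N := Nat.ceil_pos.2 (by positivity)
  have hNs : N * (e / 32) ≤ 1 / 16 := by
    rw [← hx3]
    nlinarith
  set r := √(N : ℝ) with hr
  have hr2 : r ^ 2 = N := Real.sq_sqrt (by positivity)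
  have hr0 : 0 ≤ r := Real.sqrt_nonneg _
  have hrx1 : 1 ≤ r * x := by
    by_contra hc
    have h1 := not_le.1 hc
    have h2 : (r * x) ^ 2 = N * x ^ 2 := by rw [mul_pow, hr2]
    nlinarith [mul_nonneg hr0 hx0.le]
  have hrx2 : r * x ≤ 3 / 2 := by
    by_contra hc
    have h1 := not_le.1 hc
    have h2 : (r * x) ^ 2 = N * x ^ 2 := by rw [mul_pow, hr2]
    nlinarith
  set b := e / 32 * r / 10 with hb
  have hb1 : x ^ 2 / 320 ≤ b := by
    rw [hb, ← hx3]
    have : x ^ 2 * 1 ≤ x ^ 2 * (r * x) := by gcongr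
    nlinarith
  have hbN : 16 * b * N ≤ 1 / 5 := by
    have h1 : b * N = (r * x) ^ 3 / 320 := by rw [hb, ← hr2, ← hx3]; ring
    have h2 : (r * x) ^ 3 ≤ (3 / 2) ^ 3 := by gcongr
    rw [mul_assoc, h1]
    linarith
  have hx20 : 0 < x ^ 2 := by positivity
  have hT0 : (0 : ℝ) < T := by linarith
  rw [one_div (T : ℝ), le_inv_mul_iff₀ hT0]
  by_cases hcase : 2 * N ≤ T
  · have hc1 : (2 : ℝ) * N ≤ T := by exact_mod_cast hcase
    have hsum : ∑ c ∈ Finset.range (T - N), b / 32 ≤ ∑ c ∈ Finset.range (T - N),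
        (L (N + c) + 16 * b * ∑ i ∈ Finset.Ioc c (c + N), L i) := by
      refine Finset.sum_le_sum fun c hc => ?_
      have hcT : (c : ℝ) ≤ T := by
        have := Finset.mem_range.1 hc
        exact_mod_cast (by omega : c ≤ T)
      rw [add_comm N c]
      refine window_bound hs0 hs hse A hN1 hNs ?_
      have : (c : ℝ) * e ^ 2 ≤ T * e ^ 2 := by gcongr
      nlinarith
    rw [Finset.sum_const, Finset.card_range, nsmul_eq_mul, Nat.cast_sub (by omega),
      Finset.sum_add_distrib, ← Finset.mul_sum] at hsum
    have h1 : ∑ c ∈ Finset.range (T - N), L (N + c) ≤ S := sum_range_shift_le hL (by omega)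
    have h2 := sum_windows_le hL (N := N) (T := T) (by omega)
    have hb0 : 0 < b := by linarith
    have hS0 : 0 ≤ S := Finset.sum_nonneg fun i _ => hL i
    have h3 : 16 * b * ∑ c ∈ Finset.range (T - N), ∑ i ∈ Finset.Ioc c (c + N), L i
        ≤ 16 * b * (N * S) := by gcongr
    have h4 : 16 * b * (N * S) ≤ 1 / 5 * S := by
      rw [← mul_assoc]; gcongr
    have h5 : (T : ℝ) / 2 * (b / 32) ≤ (T - N) * (b / 32) := by gcongr; linarith
    have h6 : (T : ℝ) * (x ^ 2 / 320) ≤ T * b := by gcongr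
    nlinarith
  -- For T < 2N the target T x² is bounded by a constant, and the first round alone suffices.
  · have hc1 : (T : ℝ) ≤ 2 * N := by exact_mod_cast (by omega : T ≤ 2 * N)
    have h1 : L 0 ≤ S := Finset.single_le_sum (fun i _ => hL i) (Finset.mem_range.2 hT)
    have h2 : 1 / 16 ≤ L 0 := first_loss_ge hs0.le hs hse A
    nlinarith

end MovingTarget

theorem mainTheorem3 :
    -- upper bound: the algorithm depends only on the horizon `T`, not on the rates
    (∃ (C : ℝ) (k : ℕ) (A : ℕ → MovingTarget.PricingAlgorithm),
      ∀ (T : ℕ), 1 ≤ T →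
      ∀ (ε : ℕ → ℝ), Antitone ε → (∀ t, 0 ≤ ε t ∧ ε t ≤ 1) →
      ∀ (B : MovingTarget.StochasticBuyer ε),
        MovingTarget.expectedLoss T (A T) B ≤
          C * (MovingTarget.averageRate T ε ^ (2 / 3 : ℝ) *
                (1 + Real.log (1 / MovingTarget.averageRate T ε)) ^ k) +
          C * ((T : ℝ) ^ (-(1 / 3) : ℝ) * (1 + Real.log T) ^ k)) ∧
    -- lower bound, already for constant rates known to the seller
    (∃ c : ℝ, 0 < c ∧
      ∀ (T : ℕ), 1 ≤ T →
      ∀ (e : ℝ), 0 < e → (T : ℝ) * e ^ 2 ≤ 1 →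
      ∃ B : MovingTarget.StochasticBuyer (fun _ => e),
      ∀ A : MovingTarget.PricingAlgorithm,
        c * MovingTarget.averageRate T (fun _ => e) ^ (2 / 3 : ℝ) ≤
          MovingTarget.expectedLoss T A B) := by
  refine ⟨⟨808, 1, fun _ => MovingTarget.trackingAlgorithm, fun T hT ε hε h01 B =>
    MovingTarget.upper_bound hT hε h01 B⟩, 1 / 30000, by norm_num, fun T hT e he hTe =>
    MovingTarget.lower_bound hT he hTe⟩
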